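/- For $n=0,1,2,\dots$ consider the rational function $$R_n(t)=n!^4\Bigl(t+\frac n2\Bigr)\frac{\prod_{j=1}^n(t-j)\cdot\prod_{j=1}^n(t+n+j)}{\prod_{j=0}^n(t+j)^6}$$ and its partial fraction decomposition $R_n(t)=\sum_{s=1}^{6}\sum_{i=0}^{n}\frac{A_{s,i}^{(n)}}{(t+i)^s}$ with $A^{(n)}_{s,i}\in\mathbb Q$. Put $$r_n=\sum_{k=1}^\infty R_n(k),\qquad u_n=\sum_{i=0}^nA^{(n)}_{5,i},\qquad w_n=\sum_{i=0}^nA^{(n)}_{3,i},\qquad v_n=\sum_{s=1}^{6}\sum_{i=0}^nA^{(n)}_{s,i}\sum_{l=1}^{i}\frac1{l^s}.$$ Then the series converge and $r_n=u_n\zeta(5)+w_n\zeta(3)-v_n$ for all $n\ge0$. Let $$\begin{aligned} a_0(n)&=41218n^3-48459n^2+20010n-2871,\\ a_1(n)&=2(48802112n^9+89030880n^8+36002654n^7-24317344n^6-19538418n^5\\ &\qquad+1311365n^4+3790503n^3+460056n^2-271701n-60291),\\ a_2(n)&=3874492n^8-2617900n^7-3144314n^6+2947148n^5+647130n^4\\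 &\qquad-1182926n^3+115771n^2+170716n-44541, \end{aligned}$$ and $b_0(n)=-a_0(-n)$, $b_1(n)=a_2(-n)$, $b_2(n)=-a_1(-n)$. **Theorem 2.** Each of the sequences $x_n=r_n$, $x_n=u_n$, $x_n=w_n$, $x_n=v_n$ satisfies the difference equation $$n(n+1)^5b_0(n-1)x_{n+1}-2nb_1(n)x_n-b_2(n)x_{n-1}+2(n-1)^5(2n-1)b_0(n)x_{n-2}=0,\qquad n=2,3,\dots.$$ In addition, $r_n>0$, $u_n>0$, $w_n>0$, $v_n>0$ for all $n\ge1$. The polynomial $\lambda^3-188\lambda^2-2368\lambda+4$ has three real roots $\lambda_1,\lambda_2,\lambda_3$ with $|\lambda_1|<|\lambda_2|<|\lambda_3|$, where $\lambda_1>0$ and $\lambda_3>0$, and $$\lim_{n\to\infty}\frac{\log|r_n|}n=\log\lambda_1,\qquad \lim_{n\to\infty}\frac{\log|u_n|}n=\lim_{n\to\infty}\frac{\log|w_n|}n=\lim_{n\to\infty}\frac{\log|v_n|}n=\log\lambda_3.$$ -/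

import Mathlib

open scoped PowerSeries Polynomial
open Filter Topology

/-- The term with index `k` of the very-well-poised series:
`n!^4 (k + n/2) ∏_{j=1}^n (k - j) ∏_{j=1}^n (k + n + j) / ∏_{j=0}^n (k + j)^6`. -/
noncomputable def wpTerm (n : ℕ) (k : ℝ) : ℝ :=
  (n.factorial : ℝ) ^ 4 * (k + (n : ℝ) / 2) *
    ((∏ j ∈ Finset.Icc 1 n, (k - (j : ℝ))) * ∏ j ∈ Finset.Icc 1 n, (k + (n : ℝ) + (j : ℝ))) /
    ∏ j ∈ Finset.range (n + 1), (k + (j : ℝ)) ^ 6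

/-- The very-well-poised series `r_n`, the sum of `wpTerm n k` over `k = 1, 2, 3, …`. -/
noncomputable def wpR (n : ℕ) : ℝ := ∑' k : ℕ, wpTerm n ((k : ℝ) + 1)

/-- Write `R_n(t)` for the rational function `wpTerm n t`. For `0 ≤ i ≤ n` this is the Taylor
expansion, in powers of `X`, of the function `X ^ 6 * R_n(X - i)`, which is regular at `X = 0`. -/
noncomputable def wpExpansion (n i : ℕ) : ℚ⟦X⟧ :=
  PowerSeries.C ((n.factorial : ℚ) ^ 4) *
    (PowerSeries.X + PowerSeries.C ((n : ℚ) / 2 - (i : ℚ))) *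
    ((∏ j ∈ Finset.Icc 1 n, (PowerSeries.X - PowerSeries.C ((i : ℚ) + (j : ℚ)))) *
      ∏ j ∈ Finset.Icc 1 n, (PowerSeries.X + PowerSeries.C ((n : ℚ) + (j : ℚ) - (i : ℚ)))) *
    (∏ j ∈ (Finset.range (n + 1)).erase i,
      (PowerSeries.X + PowerSeries.C ((j : ℚ) - (i : ℚ))) ^ 6)⁻¹

/-- For `1 ≤ s ≤ 6` and `0 ≤ i ≤ n`: the coefficient of `(t + i)^(-s)` in the partial fraction
decomposition of the rational function `R_n(t)`. -/
noncomputable def wpCoeff (n s i : ℕ) : ℚ := PowerSeries.coeff (6 - s) (wpExpansion n i)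

/-- The coefficient `u_n` of `ζ(5)`. -/
noncomputable def wpU (n : ℕ) : ℚ := ∑ i ∈ Finset.range (n + 1), wpCoeff n 5 i

/-- The coefficient `w_n` of `ζ(3)`. -/
noncomputable def wpW (n : ℕ) : ℚ := ∑ i ∈ Finset.range (n + 1), wpCoeff n 3 i

/-- The rational part `v_n`: the term `(t + i)^(-s)`, summed over `t = 1, 2, …`, falls short of
`ζ(s)` by `∑_{l=1}^i l^(-s)`. -/
noncomputable def wpV (n : ℕ) : ℚ :=
  ∑ s ∈ Finset.Icc 1 6, ∑ i ∈ Finset.range (n + 1),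
    wpCoeff n s i * ∑ l ∈ Finset.Icc 1 i, 1 / (l : ℚ) ^ s

/-- The polynomial `a_0`. -/
def polyA0 (x : ℝ) : ℝ := 41218 * x ^ 3 - 48459 * x ^ 2 + 20010 * x - 2871

/-- The polynomial `a_1`. -/
def polyA1 (x : ℝ) : ℝ :=
  2 * (48802112 * x ^ 9 + 89030880 * x ^ 8 + 36002654 * x ^ 7 - 24317344 * x ^ 6
    - 19538418 * x ^ 5 + 1311365 * x ^ 4 + 3790503 * x ^ 3 + 460056 * x ^ 2
    - 271701 * x - 60291)

/-- The polynomial `a_2`. -/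
def polyA2 (x : ℝ) : ℝ :=
  3874492 * x ^ 8 - 2617900 * x ^ 7 - 3144314 * x ^ 6 + 2947148 * x ^ 5 + 647130 * x ^ 4
    - 1182926 * x ^ 3 + 115771 * x ^ 2 + 170716 * x - 44541

/-- The polynomial `b_0`. -/
def polyB0 (x : ℝ) : ℝ := -polyA0 (-x)

/-- The polynomial `b_1`. -/
def polyB1 (x : ℝ) : ℝ := polyA2 (-x)

/-- The polynomial `b_2`. -/
def polyB2 (x : ℝ) : ℝ := -polyA1 (-x)

/-- The sequence `x_0, x_1, x_2, …` satisfies the third-order difference equation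
(whose first instance, relating `x_0, …, x_3`, is the one with `n = 2`). -/
def SatisfiesRecursion (x : ℕ → ℝ) : Prop :=
  ∀ n : ℕ, 2 ≤ n →
    (n : ℝ) * ((n : ℝ) + 1) ^ 5 * polyB0 ((n : ℝ) - 1) * x (n + 1)
      - 2 * (n : ℝ) * polyB1 (n : ℝ) * x n
      - polyB2 (n : ℝ) * x (n - 1)
      + 2 * ((n : ℝ) - 1) ^ 5 * (2 * (n : ℝ) - 1) * polyB0 (n : ℝ) * x (n - 2) = 0

/-- The characteristic polynomial `λ³ - 188 λ² - 2368 λ + 4` of the recursion. -/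
noncomputable def recCharPoly : ℝ[X] :=
  Polynomial.X ^ 3 - Polynomial.C 188 * Polynomial.X ^ 2 - Polynomial.C 2368 * Polynomial.X
    + Polynomial.C 4

/-!
Write `R_n(t)` for the summand.

*The recursion.* Creative telescoping: the recursion operator applied to `R_n(t)` in the index `n`
equals `S(t + 1) - S(t)` for an explicit rational function `S` (`wpTel`), whose only complicated
ingredient is a polynomial `telPoly` of degree 15 in `t`. Cancelling the common factor, this is the
polynomial identity `telPoly_identity`. It holds in every field of characteristic zero away from the
poles (`wpFun_telescope`), and it is used in two of them.

* Over `ℝ`, summing over `t = 1, 2, …` kills the right-hand side, because `S(1) = 0` and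
  `S(t) → 0`. This gives the recursion for `r_n` (`wpR_recursion`).
* Over the Laurent series `ℚ⸨X⸩` at `t = X - i`, the coefficient of `X ^ (-s)` of `R_n(X - i)` is
  the partial fraction coefficient `A_{s,i}`. Summing over `i`, the right-hand side telescopes
  between two points at which `S` has no pole. This gives the recursion for `∑_i A_{s,i}`
  (`wpSum_recursion`), hence for `u_n` and `w_n`.

*The linear form in zeta values.* The coefficients `A_{s,i}` do decompose `R_n`
(`wpTerm_partial_fractions`). The sums `∑_i A_{s,i}` vanish for `s = 1`, by comparing degrees, and
for even `s`, by the symmetry `R_n(-n - t) = -R_n(t)`. Summing the decomposition over `t` leaves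
`r_n = u_n ζ(5) + w_n ζ(3) - v_n` (`wpR_eq`), and the recursion passes to `v_n` by linearity.

*Growth of `u_n`, `w_n`, `v_n`.* After division by the leading coefficient the recursion reads
`x_{m+3} = α x_{m+2} + β x_{m+1} - γ x_m`, with `α ≥ 1`, `β ≥ γ ≥ 0` and `α → 188`, `β → 2368`,
`γ → 4`. Three initial values in nonnegative increasing order therefore force a positive increasing
sequence. Its ratios `ρ_m = x_{m+1} / x_m` are eventually at least `100`, and there the map
`(ρ, ρ') ↦ 188 + 2368 / ρ' - 4 / (ρ ρ')` is a contraction, so the ratios converge to its fixed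
point, the characteristic root of largest absolute value.

*Decay of `r_n`.* Termwise `40 R_{n+1}(k) ≤ R_n(k)` (`wpTerm_succ_le`), so the reciprocal ratios
`σ_m = r_m / r_{m+1}` are at least `40`. The recursion read backwards expresses `σ_m` by `σ_{m+1}`
and `σ_{m+2}`, again through a contraction (`contraction_step` serves both directions), with the
reciprocal of the characteristic root of least absolute value as its fixed point. The logarithmic
limits follow from the limits of the ratios by Cesàro summation.
-/

/-! ### The recursion coefficients and the telescoping certificate -/

/-- The polynomial `b_0`, over an arbitrary commutative ring. -/
def recB0 {R : Type*} [CommRing R] (n : R) : R :=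
  41218 * n ^ 3 + 48459 * n ^ 2 + 20010 * n + 2871

/-- The polynomial `b_1`, over an arbitrary commutative ring. -/
def recB1 {R : Type*} [CommRing R] (n : R) : R :=
  3874492 * n ^ 8 + 2617900 * n ^ 7 - 3144314 * n ^ 6 - 2947148 * n ^ 5 + 647130 * n ^ 4
    + 1182926 * n ^ 3 + 115771 * n ^ 2 - 170716 * n - 44541

/-- The polynomial `b_2`, over an arbitrary commutative ring. -/
def recB2 {R : Type*} [CommRing R] (n : R) : R :=
  2 * (48802112 * n ^ 9 - 89030880 * n ^ 8 + 36002654 * n ^ 7 + 24317344 * n ^ 6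
    - 19538418 * n ^ 5 - 1311365 * n ^ 4 + 3790503 * n ^ 3 - 460056 * n ^ 2
    - 271701 * n + 60291)

theorem polyB0_eq (x : ℝ) : polyB0 x = recB0 x := by
  unfold polyB0 polyA0 recB0; ring

theorem polyB1_eq (x : ℝ) : polyB1 x = recB1 x := by
  unfold polyB1 polyA2 recB1; ring

theorem polyB2_eq (x : ℝ) : polyB2 x = recB2 x := by
  unfold polyB2 polyA1 recB2; ring

/-- The constant coefficient of `telPoly n t` as a polynomial in `t`. -/
def telCoeff0 {R : Type*} [CommRing R] (n : R) : R :=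
  263960072 * n ^ 23 - 2849522880 * n ^ 22 + 13129113346 * n ^ 21 - 33893608794 * n ^ 20
    + 53441460516 * n ^ 19 - 51386096016 * n ^ 18 + 26032414022 * n ^ 17 - 345232254 * n ^ 16
    - 7944687096 * n ^ 15 + 4002029608 * n ^ 14 + 76810950 * n ^ 13 - 781978654 * n ^ 12
    + 275067228 * n ^ 11 - 777240 * n ^ 10 - 26350254 * n ^ 9 + 8369974 * n ^ 8 - 972528 * n ^ 7

/-- The coefficient of `t` in `telPoly n t`. -/
def telCoeff1 {R : Type*} [CommRing R] (n : R) : R :=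
  3545572360 * n ^ 22 - 33053966336 * n ^ 21 + 135108502114 * n ^ 20 - 315940659638 * n ^ 19
    + 458746789732 * n ^ 18 - 410923455300 * n ^ 17 + 192943153920 * n ^ 16 + 5651260566 * n ^ 15
    - 63490310562 * n ^ 14 + 30604669658 * n ^ 13 + 1199305808 * n ^ 12 - 6470141584 * n ^ 11
    + 2170606214 * n ^ 10 + 86902034 * n ^ 9 - 231727866 * n ^ 8 + 58524936 * n ^ 7
    - 5026056 * n ^ 6

/-- The coefficient of `t ^ 2` in `telPoly n t`. -/
def telCoeff2 {R : Type*} [CommRing R] (n : R) : R :=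
  17091950496 * n ^ 21 - 149592001696 * n ^ 20 + 576011270060 * n ^ 19 - 1271972520832 * n ^ 18
    + 1744960905464 * n ^ 17 - 1469226900400 * n ^ 16 + 626523369624 * n ^ 15
    + 63800864272 * n ^ 14 - 228984278434 * n ^ 13 + 98289298212 * n ^ 12 + 8932920110 * n ^ 11
    - 22572682464 * n ^ 10 + 6859680322 * n ^ 9 + 493416260 * n ^ 8 - 786591522 * n ^ 7
    + 186616248 * n ^ 6 - 15315720 * n ^ 5

/-- The coefficient of `t ^ 3` in `telPoly n t`. -/
def telCoeff3 {R : Type*} [CommRing R] (n : R) : R :=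
  44991260592 * n ^ 20 - 377593080544 * n ^ 19 + 1394014588424 * n ^ 18 - 2947256590250 * n ^ 17
    + 3855149525261 * n ^ 16 - 3058076325738 * n ^ 15 + 1161579660062 * n ^ 14
    + 236132048996 * n ^ 13 - 483884736060 * n ^ 12 + 177722046724 * n ^ 11
    + 30656518146 * n ^ 10 - 45607855862 * n ^ 9 + 11901891351 * n ^ 8 + 1481421726 * n ^ 7
    - 1515737664 * n ^ 6 + 331088996 * n ^ 5 - 25724160 * n ^ 4

/-- The coefficient of `t ^ 4` in `telPoly n t`. -/
def telCoeff4 {R : Type*} [CommRing R] (n : R) : R :=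
  75155417352 * n ^ 19 - 608256552552 * n ^ 18 + 2162156257526 * n ^ 17 - 4387448695007 * n ^ 16
    + 5471393140227 * n ^ 15 - 4066464044766 * n ^ 14 + 1328696314388 * n ^ 13
    + 468288667888 * n ^ 12 - 652774329372 * n ^ 11 + 195917262146 * n ^ 10 + 58291661884 * n ^ 9
    - 58428574961 * n ^ 8 + 12383148961 * n ^ 7 + 2595619684 * n ^ 6 - 1840486998 * n ^ 5
    + 360917760 * n ^ 4 - 25724160 * n ^ 3

/-- The coefficient of `t ^ 5` in `telPoly n t`. -/
def telCoeff5 {R : Type*} [CommRing R] (n : R) : R :=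
  85186394704 * n ^ 18 - 664601717854 * n ^ 17 + 2270867023869 * n ^ 16 - 4407661370177 * n ^ 15
    + 5207159991743 * n ^ 14 - 3575987023500 * n ^ 13 + 934456268949 * n ^ 12
    + 571202659410 * n ^ 11 - 578822133705 * n ^ 10 + 129703096676 * n ^ 9 + 67982407738 * n ^ 8
    - 48641679081 * n ^ 7 + 7556935274 * n ^ 6 + 2812800130 * n ^ 5 - 1444915836 * n ^ 4
    + 246696156 * n ^ 3 - 15434496 * n ^ 2

/-- The coefficient of `t ^ 6` in `telPoly n t`. -/
def telCoeff6 {R : Type*} [CommRing R] (n : R) : R :=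
  67257512718 * n ^ 17 - 503931352107 * n ^ 16 + 1646310980865 * n ^ 15 - 3033170050087 * n ^ 14
    + 3354350176529 * n ^ 13 - 2076389688613 * n ^ 12 + 362052968271 * n ^ 11
    + 446490379685 * n ^ 10 - 334764425001 * n ^ 9 + 44053740064 * n ^ 8 + 50153124624 * n ^ 7
    - 25921954226 * n ^ 6 + 2218780746 * n ^ 5 + 1915899944 * n ^ 4 - 723277632 * n ^ 3
    + 102329052 * n ^ 2 - 5144832 * n

/-- The coefficient of `t ^ 7` in `telPoly n t`. -/
def telCoeff7 {R : Type*} [CommRing R] (n : R) : R :=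
  36798729694 * n ^ 16 - 262986286167 * n ^ 15 + 814054839195 * n ^ 14 - 1406064163423 * n ^ 13
    + 1427752116183 * n ^ 12 - 762630715355 * n ^ 11 + 36831887453 * n ^ 10
    + 219843447897 * n ^ 9 - 119505396567 * n ^ 8 + 871801450 * n ^ 7 + 22789632592 * n ^ 6
    - 8265970858 * n ^ 5 - 87185190 * n ^ 4 + 792159452 * n ^ 3 - 217392816 * n ^ 2
    + 23231436 * n - 734976

/-- The coefficient of `t ^ 8` in `telPoly n t`. -/
def telCoeff8 {R : Type*} [CommRing R] (n : R) : R :=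
  13265065286 * n ^ 15 - 89302911559 * n ^ 14 + 257747193725 * n ^ 13 - 408366422365 * n ^ 12
    + 367873442221 * n ^ 11 - 154871790999 * n ^ 10 - 25753124557 * n ^ 9 + 61815412657 * n ^ 8
    - 22313713623 * n ^ 7 - 4390877490 * n ^ 6 + 5693334494 * n ^ 5 - 1309215278 * n ^ 4
    - 232032516 * n ^ 3 + 177257544 * n ^ 2 - 33770790 * n + 2153250

/-- The coefficient of `t ^ 9` in `telPoly n t`. -/
def telCoeff9 {R : Type*} [CommRing R] (n : R) : R :=
  2586718026 * n ^ 14 - 15807643847 * n ^ 13 + 40555565400 * n ^ 12 - 55211912401 * n ^ 11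
    + 39677412370 * n ^ 10 - 9051080177 * n ^ 9 - 7688008660 * n ^ 8 + 6372022215 * n ^ 7
    - 980930896 * n ^ 6 - 859750144 * n ^ 5 + 485755882 * n ^ 4 - 56009322 * n ^ 3
    - 35191404 * n ^ 2 + 14804268 * n - 1751310

/-- The coefficient of `t ^ 10` in `telPoly n t`. -/
def telCoeff10 {R : Type*} [CommRing R] (n : R) : R :=
  -83095488 * n ^ 13 + 884778904 * n ^ 12 - 3322988468 * n ^ 11 + 6064910282 * n ^ 10
    - 5531036286 * n ^ 9 + 1588322273 * n ^ 8 + 1337972243 * n ^ 7 - 1141330123 * n ^ 6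
    + 43328757 * n ^ 5 + 225503825 * n ^ 4 - 58914111 * n ^ 3 - 13307343 * n ^ 2 + 6286185 * n
    - 430650

/-- The coefficient of `t ^ 11` in `telPoly n t`. -/
def telCoeff11 {R : Type*} [CommRing R] (n : R) : R :=
  -214910652 * n ^ 12 + 1306529278 * n ^ 11 - 3243736758 * n ^ 10 + 4038777842 * n ^ 9
    - 2229176447 * n ^ 8 - 260521815 * n ^ 7 + 956457044 * n ^ 6 - 306490307 * n ^ 5
    - 126606738 * n ^ 4 + 88418501 * n ^ 3 - 2524494 * n ^ 2 - 7533243 * n + 1317789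

/-- The coefficient of `t ^ 12` in `telPoly n t`. -/
def telCoeff12 {R : Type*} [CommRing R] (n : R) : R :=
  -68669188 * n ^ 11 + 367059658 * n ^ 10 - 772641646 * n ^ 9 + 749642117 * n ^ 8
    - 208193251 * n ^ 7 - 203518469 * n ^ 6 + 158092487 * n ^ 5 + 3705639 * n ^ 4
    - 33417489 * n ^ 3 + 6169779 * n ^ 2 + 2493855 * n - 723492

/-- The coefficient of `t ^ 13` in `telPoly n t`. -/
def telCoeff13 {R : Type*} [CommRing R] (n : R) : R :=
  -12695144 * n ^ 10 + 59225810 * n ^ 9 - 102776401 * n ^ 8 + 69475609 * n ^ 7 + 7831971 * n ^ 6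
    - 32115293 * n ^ 5 + 7751023 * n ^ 4 + 5790799 * n ^ 3 - 2301411 * n ^ 2 - 387933 * n
    + 200970

/-- The coefficient of `t ^ 14` in `telPoly n t`. -/
def telCoeff14 {R : Type*} [CommRing R] (n : R) : R :=
  -1483848 * n ^ 9 + 5922024 * n ^ 8 - 8029314 * n ^ 7 + 2729532 * n ^ 6 + 2749674 * n ^ 5
    - 1917540 * n ^ 4 - 381342 * n ^ 3 + 426996 * n ^ 2 + 18270 * n - 34452

/-- The coefficient of `t ^ 15` in `telPoly n t`. -/
def telCoeff15 {R : Type*} [CommRing R] (n : R) : R :=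
  -82436 * n ^ 8 + 274044 * n ^ 7 - 263377 * n ^ 6 - 23944 * n ^ 5 + 136797 * n ^ 4
    - 15332 * n ^ 3 - 31407 * n ^ 2 + 2784 * n + 2871

/-- The polynomial part of the telescoping certificate: a polynomial in `t` solving the
first-order difference equation `telPoly_identity`. It carries a factor `2`, which makes all its
coefficients integral. -/
def telPoly {R : Type*} [CommRing R] (n t : R) : R :=
  telCoeff0 n + telCoeff1 n * t + telCoeff2 n * t ^ 2 + telCoeff3 n * t ^ 3 + telCoeff4 n * t ^ 4 +
  telCoeff5 n * t ^ 5 + telCoeff6 n * t ^ 6 + telCoeff7 n * t ^ 7 + telCoeff8 n * t ^ 8 +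
  telCoeff9 n * t ^ 9 + telCoeff10 n * t ^ 10 + telCoeff11 n * t ^ 11 + telCoeff12 n * t ^ 12 +
  telCoeff13 n * t ^ 13 + telCoeff14 n * t ^ 14 + telCoeff15 n * t ^ 15

set_option maxHeartbeats 4000000 in
/-- The telescoping identity after cancelling the factor common to all its terms. The four terms on
the right stand for `x_{n+1}`, `x_n`, `x_{n-1}` and `x_{n-2}`. -/
theorem telPoly_identity {R : Type*} [CommRing R] (n t : R) :
    (t + 2 * n - 3) * t ^ 7 * telPoly n (t + 1) - (t - n + 1) * (t + n + 1) ^ 7 * telPoly n t =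
    n * (n + 1) ^ 5 * recB0 (n - 1) * ((n + 1) * n * (n - 1)) ^ 4 * (2 * t + n + 1) *
      ((t - n + 1) * (t - n) * (t - n - 1)) *
      ((t + 2 * n - 3) * (t + 2 * n - 2) * (t + 2 * n - 1) * (t + 2 * n) * (t + 2 * n + 1) *
        (t + 2 * n + 2))
    - 2 * n * recB1 n * (n * (n - 1)) ^ 4 * (2 * t + n) * ((t - n + 1) * (t - n)) *
      ((t + 2 * n - 3) * (t + 2 * n - 2) * (t + 2 * n - 1) * (t + 2 * n)) * (t + n + 1) ^ 7
    - recB2 n * (n - 1) ^ 4 * (2 * t + n - 1) * (t - n + 1) * ((t + 2 * n - 3) * (t + 2 * n - 2)) *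
        ((t + n + 1) * (t + n)) ^ 7
    + 2 * (n - 1) ^ 5 * (2 * n - 1) * recB0 n * (2 * t + n - 2) *
        ((t + n + 1) * (t + n) * (t + n - 1)) ^ 7 := by
  unfold telPoly telCoeff0 telCoeff1 telCoeff2 telCoeff3 telCoeff4 telCoeff5 telCoeff6 telCoeff7
    telCoeff8 telCoeff9 telCoeff10 telCoeff11 telCoeff12 telCoeff13 telCoeff14 telCoeff15
    recB0 recB1 recB2
  ring

/-! ### The summand over an arbitrary field and its creative telescoping -/

/-- The summand without its linear factor `t + n / 2`, over an arbitrary field. Unlike the summand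
itself, it changes by an explicit rational factor when `n` or `t` increases by one. -/
def wpCore {K : Type*} [Field K] (n : ℕ) (t : K) : K :=
  (n.factorial : K) ^ 4 *
    ((∏ j ∈ Finset.Icc 1 n, (t - (j : K))) * ∏ j ∈ Finset.Icc 1 n, (t + (n : K) + (j : K))) /
    ∏ j ∈ Finset.range (n + 1), (t + (j : K)) ^ 6

/-- The summand `R_n(t)` over an arbitrary field. -/
def wpFun {K : Type*} [Field K] (n : ℕ) (t : K) : K := (t + (n : K) / 2) * wpCore n t

theorem wpTerm_eq (n : ℕ) (t : ℝ) : wpTerm n t = wpFun n t := by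
  unfold wpTerm wpFun wpCore; ring

theorem prod_Icc_one_shift_add {K : Type*} [Field K] (m : ℕ) (t : K) :
    (t + m + 1) * ∏ j ∈ Finset.Icc 1 (m + 1), (t + ((m + 1 : ℕ) : K) + (j : K)) =
      (∏ j ∈ Finset.Icc 1 m, (t + (m : K) + (j : K))) * ((t + 2 * m + 1) * (t + 2 * m + 2)) := by
  have h : ∀ k : ℕ, (t + m + 1) * ∏ j ∈ Finset.Icc 1 k, (t + ((m + 1 : ℕ) : K) + (j : K)) =
      (∏ j ∈ Finset.Icc 1 k, (t + (m : K) + (j : K))) * (t + m + k + 1) := by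
    intro k
    induction k with
    | zero => simp
    | succ k ih =>
      rw [Finset.prod_Icc_succ_top (by omega), Finset.prod_Icc_succ_top (by omega), ← mul_assoc, ih]
      push_cast; ring
  rw [h, Finset.prod_Icc_succ_top (by omega)]
  push_cast; ring

theorem wpCore_succ {K : Type*} [Field K] (m : ℕ) (t : K) (h : t + m + 1 ≠ 0) :
    wpCore (m + 1) t = wpCore m t *
      ((m + 1) ^ 4 * (t - m - 1) * ((t + 2 * m + 1) * (t + 2 * m + 2)) / (t + m + 1) ^ 7) := by
  have h1 := prod_Icc_one_shift_add m t
  unfold wpCore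
  rw [Finset.prod_range_succ _ (m + 1), Finset.prod_Icc_succ_top (by omega) (fun j => t - (j : K)),
    Nat.factorial_succ]
  have h2 : (t + ((m + 1 : ℕ) : K)) = t + m + 1 := by push_cast; ring
  have h3 : ∏ j ∈ Finset.Icc 1 (m + 1), (t + ((m + 1 : ℕ) : K) + (j : K)) =
      (∏ j ∈ Finset.Icc 1 m, (t + (m : K) + (j : K))) * ((t + 2 * m + 1) * (t + 2 * m + 2)) /
        (t + m + 1) := by
    rw [← h1]; field_simp
  rw [h3, h2, mul_comm (∏ j ∈ Finset.range (m + 1), (t + (j : K)) ^ 6), ← div_div]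
  push_cast
  field_simp
  ring

/-- The factor `t - m` stays on the left, since `wpCore m (t + 1)` need not be zero at `t = m`. -/
theorem wpCore_shift {K : Type*} [Field K] (m : ℕ) (t : K) (h0 : t ≠ 0) (h : t + m + 1 ≠ 0) :
    (t - m) * wpCore m (t + 1) = wpCore m t * (t ^ 7 * (t + 2 * m + 1) / (t + m + 1) ^ 7) := by
  have e1 : ∀ k : ℕ, (t - k) * ∏ j ∈ Finset.Icc 1 k, (t + 1 - (j : K)) =
      (∏ j ∈ Finset.Icc 1 k, (t - (j : K))) * t := by
    intro k
    induction k with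
    | zero => simp
    | succ k ih =>
      have ih' : (∏ j ∈ Finset.Icc 1 k, (t - (j : K))) * t =
        (t - k) * ∏ j ∈ Finset.Icc 1 k, (t + 1 - (j : K)) := ih.symm
      rw [Finset.prod_Icc_succ_top (by omega), Finset.prod_Icc_succ_top (by omega), mul_right_comm,
        ih']
      push_cast; ring
  have e2 : ∀ k : ℕ, (t + m + 1) * ∏ j ∈ Finset.Icc 1 k, (t + 1 + (m : K) + (j : K)) =
      (∏ j ∈ Finset.Icc 1 k, (t + (m : K) + (j : K))) * (t + m + k + 1) := by
    intro k
    induction k with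
    | zero => simp
    | succ k ih =>
      rw [Finset.prod_Icc_succ_top (by omega), Finset.prod_Icc_succ_top (by omega), ← mul_assoc, ih]
      push_cast; ring
  have e3 : ∀ k : ℕ, t ^ 6 * ∏ j ∈ Finset.range k, (t + 1 + (j : K)) ^ 6 =
      (∏ j ∈ Finset.range k, (t + (j : K)) ^ 6) * (t + k) ^ 6 := by
    intro k
    induction k with
    | zero => simp
    | succ k ih =>
      rw [Finset.prod_range_succ, Finset.prod_range_succ, ← mul_assoc, ih]
      push_cast; ring
  have e1' := e1 m
  have e2' : ∏ j ∈ Finset.Icc 1 m, (t + 1 + (m : K) + (j : K)) =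
      (∏ j ∈ Finset.Icc 1 m, (t + (m : K) + (j : K))) * (t + m + m + 1) / (t + m + 1) := by
    rw [← e2]; field_simp
  have e3' : ∏ j ∈ Finset.range (m + 1), (t + 1 + (j : K)) ^ 6 =
      (∏ j ∈ Finset.range (m + 1), (t + (j : K)) ^ 6) * ((t + m + 1) ^ 6 / t ^ 6) := by
    have := e3 (m + 1)
    push_cast at this
    field_simp
    linear_combination this
  unfold wpCore
  rw [e3', e2', ← div_div, ← mul_div_assoc, ← mul_div_assoc]
  have : (t - m) * ((m.factorial : K) ^ 4 * ((∏ j ∈ Finset.Icc 1 m, (t + 1 - (j : K))) *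
      ((∏ j ∈ Finset.Icc 1 m, (t + (m : K) + (j : K))) * (t + m + m + 1) / (t + m + 1)))) =
      (m.factorial : K) ^ 4 * ((∏ j ∈ Finset.Icc 1 m, (t - (j : K))) * t *
      ((∏ j ∈ Finset.Icc 1 m, (t + (m : K) + (j : K))) * (t + m + m + 1) / (t + m + 1))) := by
    rw [← e1']; ring
  rw [this]
  field_simp
  ring

/-- The telescoping certificate `S(t)` for the instance `n = m + 2` of the recursion. Its poles
lie in `{0, -1, …, -(m + 2)}`. -/
def wpTel {K : Type*} [Field K] (m : ℕ) (t : K) : K :=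
  wpCore m t * (t - m - 1) * telPoly ((m : K) + 2) t / (2 * ((t + m + 1) * (t + m + 2)) ^ 7)

theorem telPoly_identity_shift {R : Type*} [CommRing R] (x t : R) :
    (t + 2 * x + 1) * t ^ 7 * telPoly (x + 2) (t + 1)
      - (t - x - 1) * (t + x + 3) ^ 7 * telPoly (x + 2) t =
    (x + 2) * (x + 3) ^ 5 * recB0 (x + 1) * ((x + 3) * (x + 2) * (x + 1)) ^ 4 * (2 * t + (x + 3)) *
        ((t - x - 1) * (t - (x + 1) - 1) * (t - (x + 2) - 1)) *
        ((t + 2 * x + 1) * (t + 2 * x + 2) * (t + 2 * (x + 1) + 1) * (t + 2 * (x + 1) + 2) *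
          (t + 2 * (x + 2) + 1) * (t + 2 * (x + 2) + 2))
      - 2 * (x + 2) * recB1 (x + 2) * ((x + 2) * (x + 1)) ^ 4 * (2 * t + (x + 2)) *
        ((t - x - 1) * (t - (x + 1) - 1)) *
        ((t + 2 * x + 1) * (t + 2 * x + 2) * (t + 2 * (x + 1) + 1) * (t + 2 * (x + 1) + 2)) *
        (t + x + 3) ^ 7
      - recB2 (x + 2) * (x + 1) ^ 4 * (2 * t + (x + 1)) * (t - x - 1) *
        ((t + 2 * x + 1) * (t + 2 * x + 2)) * ((t + x + 3) * (t + x + 2)) ^ 7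
      + 2 * (x + 1) ^ 5 * (2 * x + 3) * recB0 (x + 2) * (2 * t + x) *
        ((t + x + 3) * (t + x + 2) * (t + x + 1)) ^ 7 := by
  have id := telPoly_identity (x + 2) t
  rw [show t + 2 * (x + 2) - 3 = t + 2 * x + 1 by ring,
    show t - (x + 2) + 1 = t - x - 1 by ring, show t + (x + 2) + 1 = t + x + 3 by ring,
    show x + 2 + 1 = x + 3 by ring, show x + 2 - 1 = x + 1 by ring,
    show 2 * t + (x + 2) + 1 = 2 * t + (x + 3) by ring,
    show t - (x + 2) = t - (x + 1) - 1 by ring,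
    show t - (x + 1) - 1 - 1 = t - (x + 2) - 1 by ring,
    show t + 2 * (x + 2) - 2 = t + 2 * x + 2 by ring,
    show t + 2 * (x + 2) - 1 = t + 2 * (x + 1) + 1 by ring,
    show 2 * t + (x + 2) - 1 = 2 * t + (x + 1) by ring,
    show 2 * t + (x + 2) - 2 = 2 * t + x by ring,
    show t + (x + 2) - 1 = t + x + 1 by ring,
    show t + (x + 2) = t + x + 2 by ring,
    show 2 * (x + 2) - 1 = 2 * x + 3 by ring] at id
  rw [id, show t + 2 * (x + 2) = t + 2 * (x + 1) + 2 by ring]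

/-- Creative telescoping: the recursion operator with `n = m + 2`, applied to the summand, is a
forward difference in `t`. -/
theorem wpFun_telescope {K : Type*} [Field K] [CharZero K] (m : ℕ) (t : K) (h0 : t ≠ 0)
    (h1 : t + m + 1 ≠ 0) (h2 : t + m + 2 ≠ 0) (h3 : t + m + 3 ≠ 0) :
    (m + 2) * (m + 3) ^ 5 * recB0 ((m : K) + 1) * wpFun (m + 3) t
      - 2 * (m + 2) * recB1 ((m : K) + 2) * wpFun (m + 2) t
      - recB2 ((m : K) + 2) * wpFun (m + 1) t
      + 2 * (m + 1) ^ 5 * (2 * m + 3) * recB0 ((m : K) + 2) * wpFun m t =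
    wpTel m (t + 1) - wpTel m t := by
  have s1 := wpCore_succ m t h1
  have s2 := wpCore_succ (m + 1) t (by push_cast; convert h2 using 1; ring)
  have s3 := wpCore_succ (m + 2) t (by push_cast; convert h3 using 1; ring)
  have sh := wpCore_shift m t h0 h1
  have id := telPoly_identity_shift (m : K) t
  have ht : wpTel m (t + 1) = wpCore m t * (t ^ 7 * (t + 2 * m + 1) / (t + m + 1) ^ 7) *
      telPoly ((m : K) + 2) (t + 1) / (2 * ((t + m + 2) * (t + m + 3)) ^ 7) := by
    rw [← sh]; unfold wpTel; ring
  rw [ht]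
  unfold wpTel wpFun
  rw [s3, s2, s1]
  push_cast
  -- Treating `wpCore m t` and all linear factors as independent variables keeps the final ring
  -- computation small.
  generalize wpCore m t = B at *
  generalize telPoly ((m : K) + 2) (t + 1) = Y1 at *
  generalize telPoly ((m : K) + 2) t = Y0 at *
  generalize recB0 ((m : K) + 1) = c1 at *
  generalize recB0 ((m : K) + 2) = c4 at *
  generalize recB1 ((m : K) + 2) = c2 at *
  generalize recB2 ((m : K) + 2) = c3 at *
  generalize (m : K) = x at *
  rw [show t + (x + 1) + 1 = t + x + 2 by ring, show t + (x + 2) + 1 = t + x + 3 by ring,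
    show x + 1 + 1 = x + 2 by ring, show x + 2 + 1 = x + 3 by ring,
    show t + (x + 3) / 2 = (2 * t + (x + 3)) / 2 by ring,
    show t + (x + 2) / 2 = (2 * t + (x + 2)) / 2 by ring,
    show t + (x + 1) / 2 = (2 * t + (x + 1)) / 2 by ring,
    show t + x / 2 = (2 * t + x) / 2 by ring]
  clear sh s1 s2 s3 ht
  generalize t + x + 1 = a at *
  generalize t + x + 2 = b at *
  generalize t + x + 3 = c at *
  generalize t - x - 1 = g1 at *
  generalize t - (x + 1) - 1 = g2 at *
  generalize t - (x + 2) - 1 = g3 at *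
  generalize t + 2 * x + 1 = f1 at *
  generalize t + 2 * x + 2 = f2 at *
  generalize t + 2 * (x + 1) + 1 = f3 at *
  generalize t + 2 * (x + 1) + 2 = f4 at *
  generalize t + 2 * (x + 2) + 1 = f5 at *
  generalize t + 2 * (x + 2) + 2 = f6 at *
  generalize 2 * t + (x + 3) = k3 at *
  generalize 2 * t + (x + 2) = k2 at *
  generalize 2 * t + (x + 1) = k1 at *
  generalize 2 * t + x = k0 at *
  generalize 2 * x + 3 = d at *
  generalize x + 3 = e3 at *
  generalize x + 2 = e2 at *
  generalize x + 1 = e1 at *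
  have key : B / (2 * (a * b * c) ^ 7) * (f1 * t ^ 7 * Y1 - g1 * c ^ 7 * Y0) =
      B * (t ^ 7 * f1 / a ^ 7) * Y1 / (2 * (b * c) ^ 7) - B * g1 * Y0 / (2 * (a * b) ^ 7) := by
    field_simp
  rw [← key, id]
  field_simp

/-! ### Residues as coefficients of Laurent series, and the recursion for their sums -/

theorem map_telPoly {R S : Type*} [CommRing R] [CommRing S] (f : R →+* S) (n t : R) :
    f (telPoly n t) = telPoly (f n) (f t) := by
  simp only [telPoly, telCoeff0, telCoeff1, telCoeff2, telCoeff3, telCoeff4, telCoeff5, telCoeff6,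
    telCoeff7, telCoeff8, telCoeff9, telCoeff10, telCoeff11, telCoeff12, telCoeff13, telCoeff14,
    telCoeff15, map_add, map_sub, map_mul, map_neg, map_pow, map_ofNat]

theorem map_recB0 {R S : Type*} [CommRing R] [CommRing S] (f : R →+* S) (n : R) :
    f (recB0 n) = recB0 (f n) := by
  simp only [recB0, map_add, map_mul, map_pow, map_ofNat]

theorem map_recB1 {R S : Type*} [CommRing R] [CommRing S] (f : R →+* S) (n : R) :
    f (recB1 n) = recB1 (f n) := by
  simp only [recB1, map_add, map_sub, map_mul, map_pow, map_ofNat]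

theorem map_recB2 {R S : Type*} [CommRing R] [CommRing S] (f : R →+* S) (n : R) :
    f (recB2 n) = recB2 (f n) := by
  simp only [recB2, map_add, map_sub, map_mul, map_pow, map_ofNat]

/-- The embedding of power series into Laurent series. -/
noncomputable abbrev toLaurent : ℚ⟦X⟧ →+* LaurentSeries ℚ := HahnSeries.ofPowerSeries ℤ ℚ

/-- The constants of the field of Laurent series. -/
noncomputable def laurentC : ℚ →+* LaurentSeries ℚ := toLaurent.comp (PowerSeries.C (R := ℚ))

theorem laurentC_apply (q : ℚ) : laurentC q = toLaurent (PowerSeries.C q) := rfl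

theorem coeff_laurentC_mul (q : ℚ) (x : LaurentSeries ℚ) (k : ℤ) :
    (laurentC q * x).coeff k = q * x.coeff k := by
  rw [laurentC_apply, PowerSeries.coe_C, HahnSeries.C_mul_eq_smul, HahnSeries.coeff_smul,
    smul_eq_mul]

instance charZeroLaurent : CharZero (LaurentSeries ℚ) :=
  charZero_of_injective_ringHom laurentC.injective

theorem coeff_neg_toLaurent (f : ℚ⟦X⟧) (s : ℕ) (hs : 0 < s) :
    (toLaurent f).coeff (-(s : ℤ)) = 0 := by
  rw [PowerSeries.coeff_coe, if_pos (by omega)]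

theorem toLaurent_div (f g : ℚ⟦X⟧) (hg : PowerSeries.constantCoeff g ≠ 0) :
    toLaurent f / toLaurent g = toLaurent (f * g⁻¹) := by
  have h : toLaurent g ≠ 0 := by
    intro h
    rw [map_eq_zero_iff _ HahnSeries.ofPowerSeries_injective] at h
    rw [h, map_zero] at hg
    exact hg rfl
  rw [div_eq_iff h, ← map_mul, mul_assoc, mul_comm g⁻¹, PowerSeries.mul_inv_cancel _ hg, mul_one]

/-- The numerator of `wpCore n` at a power series `y`. -/
noncomputable def wpNum (n : ℕ) (y : ℚ⟦X⟧) : ℚ⟦X⟧ :=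
  PowerSeries.C ((n.factorial : ℚ) ^ 4) *
    ((∏ j ∈ Finset.Icc 1 n, (y - PowerSeries.C (j : ℚ))) *
      ∏ j ∈ Finset.Icc 1 n, (y + PowerSeries.C ((n : ℚ) + (j : ℚ))))

/-- The denominator of `wpCore n` at a power series `y`. -/
noncomputable def wpDen (n : ℕ) (y : ℚ⟦X⟧) : ℚ⟦X⟧ :=
  ∏ j ∈ Finset.range (n + 1), (y + PowerSeries.C (j : ℚ)) ^ 6

theorem wpCore_toLaurent (n : ℕ) (y : ℚ⟦X⟧) :
    wpCore n (toLaurent y) = toLaurent (wpNum n y) / toLaurent (wpDen n y) := by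
  unfold wpCore wpNum wpDen
  simp only [map_mul, map_prod, map_sub, map_add, map_pow, map_natCast, add_assoc]

theorem wpFun_toLaurent (n : ℕ) (y : ℚ⟦X⟧) :
    wpFun n (toLaurent y) =
      toLaurent ((y + PowerSeries.C ((n : ℚ) / 2)) * wpNum n y) / toLaurent (wpDen n y) := by
  rw [wpFun, wpCore_toLaurent, map_mul, map_add, ← laurentC_apply, map_div₀, map_natCast,
    map_ofNat, mul_div_assoc]

/-- The point `X - a`, at which rational functions of `t` are expanded around `t = -a`. -/
noncomputable def laurentPt (a : ℚ) : ℚ⟦X⟧ := PowerSeries.X - PowerSeries.C a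

theorem constantCoeff_laurentPt (a : ℚ) : PowerSeries.constantCoeff (laurentPt a) = -a := by
  simp [laurentPt]

theorem constantCoeff_wpDen (n : ℕ) (a : ℚ) (h : ∀ j ≤ n, (j : ℚ) ≠ a) :
    PowerSeries.constantCoeff (wpDen n (laurentPt a)) ≠ 0 := by
  simp only [wpDen, map_prod, map_pow, map_add, constantCoeff_laurentPt,
    PowerSeries.constantCoeff_C]
  refine Finset.prod_ne_zero_iff.2 fun j hj => pow_ne_zero _ ?_
  have := h j (by simpa [Nat.lt_succ_iff] using hj)
  intro h'
  exact this (by linarith)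

/-- The principal part vanishes at a point that is not a pole. -/
theorem coeff_wpFun_of_regular (n s : ℕ) (hs : 0 < s) (a : ℚ) (h : ∀ j ≤ n, (j : ℚ) ≠ a) :
    (wpFun n (toLaurent (laurentPt a))).coeff (-(s : ℤ)) = 0 := by
  rw [wpFun_toLaurent, toLaurent_div _ _ (constantCoeff_wpDen n a h), coeff_neg_toLaurent _ _ hs]

theorem coeff_toLaurent_div_X_pow_six (f : ℚ⟦X⟧) (s : ℕ) (hs : s ≤ 6) :
    (toLaurent f / toLaurent (PowerSeries.X ^ 6)).coeff (-(s : ℤ)) =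
      PowerSeries.coeff (6 - s) f := by
  have h6 : toLaurent (PowerSeries.X ^ 6) = HahnSeries.single (6 : ℤ) (1 : ℚ) := by
    have := HahnSeries.ofPowerSeries_X_pow (Γ := ℤ) (R := ℚ) 6
    exact this
  have hne : toLaurent (PowerSeries.X ^ 6) ≠ 0 := by
    rw [h6]; simp
  obtain ⟨g, hg⟩ : ∃ g, g = toLaurent f / toLaurent (PowerSeries.X ^ 6) := ⟨_, rfl⟩
  rw [← hg]
  have hf : toLaurent f = HahnSeries.single (6 : ℤ) (1 : ℚ) * g := by
    rw [hg, ← h6]; field_simp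
  have := HahnSeries.coeff_single_mul_add (r := (1 : ℚ)) (x := g) (a := -(s : ℤ)) (b := 6)
  rw [← hf, one_mul] at this
  rw [← this, show -(s : ℤ) + 6 = ((6 - s : ℕ) : ℤ) by omega, LaurentSeries.coeff_coe_powerSeries]

/-- The partial fraction coefficients are the coefficients of the principal part at `-i`. -/
theorem coeff_wpFun (n s i : ℕ) (hs : s ≤ 6) (hi : i ≤ n) :
    (wpFun n (toLaurent (laurentPt i))).coeff (-(s : ℤ)) = wpCoeff n s i := by
  have hmem : i ∈ Finset.range (n + 1) := Finset.mem_range.2 (by omega)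
  have hy : ∀ q : ℚ, laurentPt i + PowerSeries.C q = PowerSeries.X + PowerSeries.C (q - i) := by
    intro q; rw [laurentPt, map_sub]; ring
  have hy' : ∀ q : ℚ, laurentPt i - PowerSeries.C q = PowerSeries.X - PowerSeries.C (i + q) := by
    intro q; rw [laurentPt, map_add]; ring
  set D : ℚ⟦X⟧ := ∏ j ∈ (Finset.range (n + 1)).erase i,
      (PowerSeries.X + PowerSeries.C ((j : ℚ) - (i : ℚ))) ^ 6 with hD
  have hDc : PowerSeries.constantCoeff D ≠ 0 := by
    rw [hD]
    simp only [map_prod, map_pow, map_add, PowerSeries.constantCoeff_X, PowerSeries.constantCoeff_C,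
      zero_add]
    refine Finset.prod_ne_zero_iff.2 fun j hj => pow_ne_zero _ ?_
    rw [sub_ne_zero]
    exact_mod_cast Finset.ne_of_mem_erase hj
  have hden : wpDen n (laurentPt i) = PowerSeries.X ^ 6 * D := by
    rw [wpDen, ← Finset.mul_prod_erase _ _ hmem]
    simp only [hy, sub_self, map_zero, add_zero, hD]
  rw [wpFun_toLaurent, hden, mul_comm (PowerSeries.X ^ 6) D, map_mul toLaurent D, ← div_div,
    toLaurent_div _ _ hDc, coeff_toLaurent_div_X_pow_six _ _ hs, wpCoeff, wpExpansion]
  congr 1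
  rw [← hD]
  congr 1
  simp only [wpNum, hy, hy']
  ring

theorem coeff_wpTel_of_regular (m s : ℕ) (hs : 0 < s) (a : ℚ) (h : ∀ j ≤ m + 2, (j : ℚ) ≠ a) :
    (wpTel m (toLaurent (laurentPt a))).coeff (-(s : ℤ)) = 0 := by
  have e : wpTel m (toLaurent (laurentPt a)) =
      toLaurent (wpNum m (laurentPt a) * (laurentPt a - PowerSeries.C ((m : ℚ) + 1)) *
        telPoly ((m : ℚ⟦X⟧) + 2) (laurentPt a)) /
      toLaurent (wpDen m (laurentPt a) * (2 * ((laurentPt a + PowerSeries.C ((m : ℚ) + 1)) *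
        (laurentPt a + PowerSeries.C ((m : ℚ) + 2))) ^ 7)) := by
    rw [wpTel, wpCore_toLaurent]
    simp only [map_mul, map_sub, map_add, map_pow, map_natCast, map_ofNat, map_one,
      map_telPoly]
    rw [← sub_sub, ← add_assoc, ← add_assoc]
    simp only [div_eq_mul_inv, mul_inv]
    ring
  rw [e, toLaurent_div, coeff_neg_toLaurent _ _ hs]
  have h1 := h (m + 1) (by omega)
  have h2 := h (m + 2) (by omega)
  push_cast at h1 h2
  simp only [map_mul, map_pow, map_add, constantCoeff_laurentPt, PowerSeries.constantCoeff_C]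
  refine mul_ne_zero (constantCoeff_wpDen m a fun j hj => h j (by omega))
    (mul_ne_zero ?_ (pow_ne_zero _ (mul_ne_zero ?_ ?_)))
  · rw [map_ofNat]; norm_num
  · intro h'; exact h1 (by linarith)
  · intro h'; exact h2 (by linarith)

/-- The sum of the partial fraction coefficients of order `s` over all poles. -/
noncomputable def wpSum (s n : ℕ) : ℚ := ∑ i ∈ Finset.range (n + 1), wpCoeff n s i

/-- The range of the sum may be enlarged, since there are no further poles. This lets `R_m`, …,
`R_{m+3}` share one range. -/
theorem sum_coeff_wpFun (n s N : ℕ) (hs : s ≤ 6) (hs0 : 0 < s) (hN : n ≤ N) :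
    ∑ i ∈ Finset.range (N + 1), (wpFun n (toLaurent (laurentPt (i : ℚ)))).coeff (-(s : ℤ)) =
      wpSum s n := by
  rw [wpSum, ← Finset.sum_subset (Finset.range_subset_range.2 (by omega : n + 1 ≤ N + 1))]
  · refine Finset.sum_congr rfl fun i hi => coeff_wpFun n s i hs ?_
    have := Finset.mem_range.1 hi
    omega
  · intro i _ hi
    refine coeff_wpFun_of_regular n s hs0 _ fun j hj h => ?_
    have : j = i := by exact_mod_cast h
    exact hi (Finset.mem_range.2 (by omega))

theorem wpSum_recursion (s m : ℕ) (hs : s ≤ 6) (hs0 : 0 < s) :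
    ((m : ℚ) + 2) * (m + 3) ^ 5 * recB0 ((m : ℚ) + 1) * wpSum s (m + 3)
      - 2 * (m + 2) * recB1 ((m : ℚ) + 2) * wpSum s (m + 2)
      - recB2 ((m : ℚ) + 2) * wpSum s (m + 1)
      + 2 * (m + 1) ^ 5 * (2 * m + 3) * recB0 ((m : ℚ) + 2) * wpSum s m = 0 := by
  have hne : ∀ (a : ℚ) (k : ℕ), toLaurent (laurentPt a) + k ≠ 0 := by
    intro a k h
    have h' : toLaurent (laurentPt a + PowerSeries.C (k : ℚ)) = 0 := by
      rw [map_add, ← laurentC_apply, map_natCast, h]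
    rw [map_eq_zero_iff _ HahnSeries.ofPowerSeries_injective] at h'
    have := congrArg (PowerSeries.coeff 1) h'
    rw [laurentPt, map_add, map_sub, PowerSeries.coeff_C, PowerSeries.coeff_C,
      PowerSeries.coeff_one_X] at this
    simp at this
  -- The points `X - i` for consecutive `i` differ by one, so the certificate telescopes.
  have key : ∀ i : ℕ,
      laurentC (((m : ℚ) + 2) * (m + 3) ^ 5 * recB0 ((m : ℚ) + 1)) *
          wpFun (m + 3) (toLaurent (laurentPt i))
        - laurentC (2 * (m + 2) * recB1 ((m : ℚ) + 2)) * wpFun (m + 2) (toLaurent (laurentPt i))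
        - laurentC (recB2 ((m : ℚ) + 2)) * wpFun (m + 1) (toLaurent (laurentPt i))
        + laurentC (2 * (m + 1) ^ 5 * (2 * m + 3) * recB0 ((m : ℚ) + 2)) *
          wpFun m (toLaurent (laurentPt i)) =
      wpTel m (toLaurent (laurentPt ((i : ℚ) - 1))) -
        wpTel m (toLaurent (laurentPt (((i + 1 : ℕ) : ℚ) - 1))) := by
    intro i
    have t := wpFun_telescope m (toLaurent (laurentPt (i : ℚ)))
      (by simpa using hne i 0) (by simpa [add_assoc] using hne i (m + 1))
      (by simpa [add_assoc] using hne i (m + 2)) (by simpa [add_assoc] using hne i (m + 3))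
    have e : toLaurent (laurentPt ((i : ℚ) - 1)) = toLaurent (laurentPt (i : ℚ)) + 1 := by
      simp only [laurentPt, map_sub, map_one]; ring
    rw [e, show ((i + 1 : ℕ) : ℚ) - 1 = i by push_cast; ring, ← t]
    simp only [map_mul, map_add, map_pow, map_natCast, map_ofNat, map_one, map_recB0, map_recB1,
      map_recB2]
  have key2 := fun i : ℕ => congrArg (fun x : LaurentSeries ℚ => x.coeff (-(s : ℤ))) (key i)
  simp only [HahnSeries.coeff_sub, HahnSeries.coeff_add, coeff_laurentC_mul] at key2
  have key3 := Finset.sum_congr (rfl : Finset.range (m + 3 + 1) = _) fun i _ => key2 i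
  rw [Finset.sum_range_sub', Finset.sum_add_distrib, Finset.sum_sub_distrib,
    Finset.sum_sub_distrib, ← Finset.mul_sum, ← Finset.mul_sum, ← Finset.mul_sum,
    ← Finset.mul_sum, sum_coeff_wpFun _ _ _ hs hs0 (by omega),
    sum_coeff_wpFun _ _ _ hs hs0 (by omega), sum_coeff_wpFun _ _ _ hs hs0 (by omega),
    sum_coeff_wpFun _ _ _ hs hs0 (by omega), coeff_wpTel_of_regular _ _ hs0,
    coeff_wpTel_of_regular _ _ hs0, sub_zero] at key3
  · exact key3
  · intro j hj h
    have : (j : ℚ) = ((m + 3 : ℕ) : ℚ) := by rw [h]; push_cast; ring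
    have : j = m + 3 := by exact_mod_cast this
    omega
  · intro j hj h
    have : (0 : ℚ) ≤ j := Nat.cast_nonneg j
    rw [h] at this
    norm_num at this

/-! ### Partial fractions and the symmetry of their coefficients -/

/-- The factors of the denominator of `R_n(X - i)` that do not vanish at `X = 0`. -/
noncomputable def wpLocalDen (n i : ℕ) : ℚ⟦X⟧ :=
  ∏ j ∈ (Finset.range (n + 1)).erase i,
    (PowerSeries.X + PowerSeries.C ((j : ℚ) - (i : ℚ))) ^ 6

theorem constantCoeff_wpLocalDen (n i : ℕ) : PowerSeries.constantCoeff (wpLocalDen n i) ≠ 0 := by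
  simp only [wpLocalDen, map_prod, map_pow, map_add, PowerSeries.constantCoeff_X,
    PowerSeries.constantCoeff_C, zero_add]
  refine Finset.prod_ne_zero_iff.2 fun j hj => pow_ne_zero _ ?_
  rw [sub_ne_zero]
  exact_mod_cast Finset.ne_of_mem_erase hj

theorem wpExpansion_mul_wpLocalDen (n i : ℕ) : wpExpansion n i * wpLocalDen n i =
    PowerSeries.C ((n.factorial : ℚ) ^ 4) *
      (PowerSeries.X + PowerSeries.C ((n : ℚ) / 2 - (i : ℚ))) *
      ((∏ j ∈ Finset.Icc 1 n, (PowerSeries.X - PowerSeries.C ((i : ℚ) + (j : ℚ)))) *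
        ∏ j ∈ Finset.Icc 1 n, (PowerSeries.X + PowerSeries.C ((n : ℚ) + (j : ℚ) - (i : ℚ)))) :=
  (PowerSeries.eq_mul_inv_iff_mul_eq (constantCoeff_wpLocalDen n i)).1 rfl

/-- The symmetry `R_n(-n - t) = -R_n(t)`, read on the partial fraction coefficients. -/
theorem wpCoeff_reflect (n s i : ℕ) (hs : s ≤ 6) (hi : i ≤ n) :
    wpCoeff n s (n - i) = -(-1) ^ s * wpCoeff n s i := by
  have hX : PowerSeries.rescale (-1 : ℚ) PowerSeries.X = -PowerSeries.X := by
    rw [PowerSeries.rescale_X]; simp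
  have hC : ∀ q : ℚ, PowerSeries.rescale (-1 : ℚ) (PowerSeries.C q) = PowerSeries.C q := by
    intro q
    ext k
    rw [PowerSeries.coeff_rescale, PowerSeries.coeff_C]
    split_ifs with h <;> simp [h]
  have hcast : ((n - i : ℕ) : ℚ) = n - i := by rw [Nat.cast_sub hi]
  have hden : PowerSeries.rescale (-1 : ℚ) (wpLocalDen n i) =
      wpLocalDen n (n - i) := by
    simp only [wpLocalDen, map_prod, map_pow, map_add, hX, hC]
    refine Finset.prod_bij' (fun j _ => n - j) (fun j _ => n - j) ?_ ?_ ?_ ?_ ?_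
    · intro j hj
      simp only [Finset.mem_erase, Finset.mem_range] at hj ⊢
      omega
    · intro j hj
      simp only [Finset.mem_erase, Finset.mem_range] at hj ⊢
      omega
    · intro j hj
      simp only [Finset.mem_erase, Finset.mem_range] at hj
      omega
    · intro j hj
      simp only [Finset.mem_erase, Finset.mem_range] at hj
      omega
    · intro j hj
      simp only [Finset.mem_erase, Finset.mem_range] at hj
      rw [hcast, Nat.cast_sub (by omega)]
      simp only [map_sub]
      ring
  have hneg : ∀ q : ℚ, -PowerSeries.X + PowerSeries.C q = -(PowerSeries.X - PowerSeries.C q) := by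
    intro q; ring
  have hneg' : ∀ q : ℚ, -PowerSeries.X - PowerSeries.C q = -(PowerSeries.X + PowerSeries.C q) := by
    intro q; ring
  have hE : PowerSeries.rescale (-1 : ℚ) (wpExpansion n i) = -wpExpansion n (n - i) := by
    have h1 := congrArg (PowerSeries.rescale (-1 : ℚ)) (wpExpansion_mul_wpLocalDen n i)
    have h2 := wpExpansion_mul_wpLocalDen n (n - i)
    rw [map_mul, hden] at h1
    have hne : wpLocalDen n (n - i) ≠ 0 := by
      intro h; apply constantCoeff_wpLocalDen n (n - i); rw [h, map_zero]
    apply mul_right_cancel₀ hne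
    rw [h1, neg_mul, h2]
    simp only [map_mul, map_prod, map_add, map_sub, hX, hC]
    simp only [← map_add, ← map_sub, hneg, hneg', Finset.prod_neg, hcast]
    have a1 : ∀ j : ℕ, (n : ℚ) - i + j = n + j - i := fun j => by ring
    have a2 : ∀ j : ℕ, (n : ℚ) + j - (n - i) = i + j := fun j => by ring
    have a3 : (n : ℚ) / 2 - (n - i) = -(n / 2 - i) := by ring
    simp only [a1, a2, a3, map_neg, ← sub_eq_add_neg]
    have hs : ((-1 : ℚ⟦X⟧) ^ (Finset.Icc 1 n).card) * (-1) ^ (Finset.Icc 1 n).card = 1 := by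
      rw [← mul_pow]; simp
    linear_combination (-(PowerSeries.C ((n.factorial : ℚ) ^ 4) *
      (PowerSeries.X - PowerSeries.C ((n : ℚ) / 2 - (i : ℚ))) *
      ((∏ j ∈ Finset.Icc 1 n, (PowerSeries.X - PowerSeries.C ((n : ℚ) + (j : ℚ) - i))) *
      ∏ j ∈ Finset.Icc 1 n, (PowerSeries.X + PowerSeries.C ((i : ℚ) + (j : ℚ)))))) * hs
  have h := congrArg (PowerSeries.coeff (6 - s)) hE
  rw [PowerSeries.coeff_rescale, map_neg] at h
  have hp : (-1 : ℚ) ^ (6 - s) = (-1) ^ s := by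
    interval_cases s <;> norm_num
  rw [hp] at h
  unfold wpCoeff
  linarith

theorem wpSum_eq_zero_of_even (n s : ℕ) (hs : s ≤ 6) (he : Even s) : wpSum s n = 0 := by
  have h : wpSum s n = -wpSum s n := by
    unfold wpSum
    rw [← Finset.sum_neg_distrib]
    conv_lhs => rw [← Finset.sum_range_reflect]
    refine Finset.sum_congr rfl fun i hi => ?_
    have := Finset.mem_range.1 hi
    rw [show n + 1 - 1 - i = n - i by omega, wpCoeff_reflect n s i hs (by omega), he.neg_one_pow]
    ring
  linarith

/-- The numerator of `R_n(t)`, as a polynomial in `t`. -/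
noncomputable def wpNumPoly (n : ℕ) : ℚ[X] :=
  Polynomial.C ((n.factorial : ℚ) ^ 4) * (Polynomial.X + Polynomial.C ((n : ℚ) / 2)) *
    ((∏ j ∈ Finset.Icc 1 n, (Polynomial.X - Polynomial.C (j : ℚ))) *
      ∏ j ∈ Finset.Icc 1 n, (Polynomial.X + Polynomial.C ((n : ℚ) + (j : ℚ))))

/-- The denominator of `R_n(t)` without the factor `(t + i) ^ 6`. -/
noncomputable def wpCofactor (n i : ℕ) : ℚ[X] :=
  ∏ j ∈ (Finset.range (n + 1)).erase i, (Polynomial.X + Polynomial.C (j : ℚ)) ^ 6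

theorem natDegree_wpNumPoly_le (n : ℕ) : (wpNumPoly n).natDegree ≤ 2 * n + 1 := by
  unfold wpNumPoly
  refine (Polynomial.natDegree_mul_le_of_le (m := 1) (n := n + n) ?_ ?_).trans (by omega)
  · exact (Polynomial.natDegree_C_mul_le _ _).trans (Polynomial.natDegree_X_add_C _).le
  · refine Polynomial.natDegree_mul_le_of_le ?_ ?_
    · refine (Polynomial.natDegree_prod_le _ _).trans ?_
      simp only [Polynomial.natDegree_X_sub_C]
      simp
    · refine (Polynomial.natDegree_prod_le _ _).trans ?_
      simp only [Polynomial.natDegree_X_add_C]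
      simp

theorem wpCofactor_monic (n i : ℕ) : (wpCofactor n i).Monic :=
  Polynomial.monic_prod_of_monic _ _ fun _ _ => (Polynomial.monic_X_add_C _).pow 6

theorem natDegree_wpCofactor (n i : ℕ) (hi : i ≤ n) : (wpCofactor n i).natDegree = 6 * n := by
  unfold wpCofactor
  rw [Polynomial.natDegree_prod_of_monic _ _ fun _ _ => (Polynomial.monic_X_add_C _).pow 6]
  simp only [Polynomial.natDegree_pow, Polynomial.natDegree_X_add_C]
  rw [Finset.sum_const, Finset.card_erase_of_mem (Finset.mem_range.2 (by omega)), Finset.card_range]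
  simp [mul_comm]

theorem natDegree_pow_mul_wpCofactor (n i k : ℕ) (hi : i ≤ n) :
    ((Polynomial.X + Polynomial.C (i : ℚ)) ^ k * wpCofactor n i).natDegree = k + 6 * n := by
  rw [((Polynomial.monic_X_add_C _).pow k).natDegree_mul (wpCofactor_monic n i),
    natDegree_wpCofactor n i hi, Polynomial.natDegree_pow, Polynomial.natDegree_X_add_C, mul_one]

theorem X_add_C_pow_dvd_of_comp (f : ℚ[X]) (a : ℚ) (k : ℕ)
    (h : Polynomial.X ^ k ∣ f.comp (Polynomial.X - Polynomial.C a)) :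
    (Polynomial.X + Polynomial.C a) ^ k ∣ f := by
  obtain ⟨g, hg⟩ := h
  refine ⟨g.comp (Polynomial.X + Polynomial.C a), ?_⟩
  have := congrArg (fun p : ℚ[X] => p.comp (Polynomial.X + Polynomial.C a)) hg
  simpa [Polynomial.comp_assoc] using this

theorem X_add_C_pow_six_dvd_sub (n i : ℕ) :
    (Polynomial.X + Polynomial.C (i : ℚ)) ^ 6 ∣ wpNumPoly n -
      ∑ s ∈ Finset.Icc 1 6, Polynomial.C (wpCoeff n s i) *
        ((Polynomial.X + Polynomial.C (i : ℚ)) ^ (6 - s) * wpCofactor n i) := by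
  apply X_add_C_pow_dvd_of_comp
  rw [Polynomial.X_pow_dvd_iff]
  intro d hd
  rw [← Polynomial.coeff_coe]
  revert d
  rw [← PowerSeries.X_pow_dvd_iff]
  let Φ : ℚ[X] →+* ℚ⟦X⟧ := Polynomial.coeToPowerSeries.ringHom.comp
    (Polynomial.compRingHom (Polynomial.X - Polynomial.C (i : ℚ)))
  have hΦX : Φ Polynomial.X = PowerSeries.X - PowerSeries.C (i : ℚ) := by
    simp only [Φ, RingHom.comp_apply, Polynomial.coe_compRingHom_apply, Polynomial.X_comp, map_sub,
      Polynomial.coeToPowerSeries.ringHom_apply, Polynomial.coe_X, Polynomial.coe_C]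
  have hΦC : ∀ q : ℚ, Φ (Polynomial.C q) = PowerSeries.C q := by
    intro q
    simp only [Φ, RingHom.comp_apply, Polynomial.coe_compRingHom_apply, Polynomial.C_comp,
      Polynomial.coeToPowerSeries.ringHom_apply, Polynomial.coe_C]
  change PowerSeries.X ^ 6 ∣ Φ _
  have e1 : Φ (wpNumPoly n) = wpExpansion n i * wpLocalDen n i := by
    rw [wpExpansion_mul_wpLocalDen, wpNumPoly]
    simp only [map_mul, map_add, map_sub, map_prod, hΦX, hΦC]
    congr 1
    · ring
    · congr 1 <;> refine Finset.prod_congr rfl fun j _ => ?_ <;> ring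
  have e2 : Φ (wpCofactor n i) = wpLocalDen n i := by
    simp only [wpCofactor, wpLocalDen, map_prod, map_pow, map_add, map_sub, hΦX, hΦC]
    refine Finset.prod_congr rfl fun j _ => ?_
    ring
  have e3 : Φ (wpNumPoly n - ∑ s ∈ Finset.Icc 1 6, Polynomial.C (wpCoeff n s i) *
        ((Polynomial.X + Polynomial.C (i : ℚ)) ^ (6 - s) * wpCofactor n i)) =
      (wpExpansion n i - ∑ s ∈ Finset.Icc 1 6, PowerSeries.C (wpCoeff n s i) *
        PowerSeries.X ^ (6 - s)) * wpLocalDen n i := by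
    simp only [map_sub, map_sum, map_mul, map_pow, map_add, e1, e2, hΦX, hΦC, sub_add_cancel]
    rw [sub_mul, Finset.sum_mul]
    simp only [mul_assoc]
  rw [e3]
  apply Dvd.dvd.mul_right
  rw [PowerSeries.X_pow_dvd_iff]
  intro d hd
  rw [map_sub, map_sum, Finset.sum_eq_single (6 - d)]
  · rw [wpCoeff, show 6 - (6 - d) = d by omega, PowerSeries.coeff_C_mul,
      PowerSeries.coeff_X_pow_self, mul_one, sub_self]
  · intro s hs hne
    have := Finset.mem_Icc.1 hs
    rw [PowerSeries.coeff_C_mul, PowerSeries.coeff_X_pow, if_neg (by omega), mul_zero]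
  · intro h
    exact absurd (Finset.mem_Icc.2 (by omega)) h

theorem natDegree_C_mul_pow_mul_wpCofactor_le (n i s : ℕ) (q : ℚ) (hi : i ≤ n) (hs : 1 ≤ s) :
    (Polynomial.C q * ((Polynomial.X + Polynomial.C (i : ℚ)) ^ (6 - s) *
      wpCofactor n i)).natDegree ≤ 6 * n + 5 := by
  refine (Polynomial.natDegree_C_mul_le _ _).trans ?_
  rw [natDegree_pow_mul_wpCofactor n i _ hi]
  omega

/-- The partial fraction decomposition after clearing denominators. Both sides agree modulo each
`(t + i) ^ 6`, and their degrees are smaller than that of the product of these factors. -/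
theorem wpNumPoly_eq_sum (n : ℕ) :
    wpNumPoly n = ∑ i ∈ Finset.range (n + 1), ∑ s ∈ Finset.Icc 1 6,
      Polynomial.C (wpCoeff n s i) *
        ((Polynomial.X + Polynomial.C (i : ℚ)) ^ (6 - s) * wpCofactor n i) := by
  rw [← sub_eq_zero]
  have hdvd : (∏ i ∈ Finset.range (n + 1), (Polynomial.X + Polynomial.C (i : ℚ)) ^ 6) ∣
      wpNumPoly n - ∑ i ∈ Finset.range (n + 1), ∑ s ∈ Finset.Icc 1 6,
      Polynomial.C (wpCoeff n s i) *
        ((Polynomial.X + Polynomial.C (i : ℚ)) ^ (6 - s) * wpCofactor n i) := by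
    apply Finset.prod_dvd_of_coprime
    · intro i _ j _ hij
      apply IsCoprime.pow
      have := Polynomial.pairwise_coprime_X_sub_C (K := ℚ) (s := fun k : ℕ => -(k : ℚ))
        (fun a b h => by simpa using h) hij
      simpa using this
    · intro i hi
      rw [← Finset.add_sum_erase _ _ hi, ← sub_sub]
      apply dvd_sub (X_add_C_pow_six_dvd_sub n i)
      refine Finset.dvd_sum fun j hj => Finset.dvd_sum fun s _ => ?_
      apply Dvd.dvd.mul_left
      apply Dvd.dvd.mul_left
      exact Finset.dvd_prod_of_mem _
        (Finset.mem_erase.2 ⟨(Finset.ne_of_mem_erase hj).symm, hi⟩)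
  have hmon : (∏ i ∈ Finset.range (n + 1), (Polynomial.X + Polynomial.C (i : ℚ)) ^ 6).Monic :=
    Polynomial.monic_prod_of_monic _ _ fun _ _ => (Polynomial.monic_X_add_C _).pow 6
  have hdeg : (∏ i ∈ Finset.range (n + 1),
      (Polynomial.X + Polynomial.C (i : ℚ)) ^ 6).natDegree = 6 * n + 6 := by
    rw [Polynomial.natDegree_prod_of_monic _ _ fun _ _ => (Polynomial.monic_X_add_C _).pow 6]
    simp only [Polynomial.natDegree_pow, Polynomial.natDegree_X_add_C]
    rw [Finset.sum_const, Finset.card_range]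
    simp only [smul_eq_mul]; ring
  refine Polynomial.eq_zero_of_dvd_of_natDegree_lt hdvd ?_
  rw [hdeg]
  refine (Polynomial.natDegree_sub_le_of_le (m := 6 * n + 5) (n := 6 * n + 5) ?_ ?_).trans_lt
    (by rw [max_self]; omega)
  · exact (natDegree_wpNumPoly_le n).trans (by omega)
  · refine Polynomial.natDegree_sum_le_of_forall_le _ _ fun i hi => ?_
    refine Polynomial.natDegree_sum_le_of_forall_le _ _ fun s hs => ?_
    exact natDegree_C_mul_pow_mul_wpCofactor_le n i s _
      (by have := Finset.mem_range.1 hi; omega) (Finset.mem_Icc.1 hs).1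

/-- The sum of the residues vanishes, since `R_n(t) = O(t ^ (-2))`: compare the coefficients of
`t ^ (6 n + 5)` in `wpNumPoly_eq_sum`. -/
theorem wpSum_order_one (n : ℕ) : wpSum 1 n = 0 := by
  have h := congrArg (fun p : ℚ[X] => p.coeff (6 * n + 5)) (wpNumPoly_eq_sum n)
  simp only [Polynomial.finsetSum_coeff] at h
  rw [Polynomial.coeff_eq_zero_of_natDegree_lt
    ((natDegree_wpNumPoly_le n).trans_lt (by omega))] at h
  rw [h, wpSum]
  refine Finset.sum_congr rfl fun i hi => ?_
  have hi' : i ≤ n := by have := Finset.mem_range.1 hi; omega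
  rw [Finset.sum_eq_single 1]
  · have hm : ((Polynomial.X + Polynomial.C (i : ℚ)) ^ (6 - 1) * wpCofactor n i).Monic :=
      ((Polynomial.monic_X_add_C _).pow 5).mul (wpCofactor_monic n i)
    have hc := hm.coeff_natDegree
    rw [natDegree_pow_mul_wpCofactor n i _ hi', show 6 - 1 + 6 * n = 6 * n + 5 by omega] at hc
    rw [Polynomial.coeff_C_mul, hc, mul_one]
  · intro s hs hne
    have := Finset.mem_Icc.1 hs
    rw [Polynomial.coeff_C_mul, Polynomial.coeff_eq_zero_of_natDegree_lt, mul_zero]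
    rw [natDegree_pow_mul_wpCofactor n i _ hi']
    omega
  · intro h
    exact absurd (Finset.mem_Icc.2 (by omega)) h

theorem wpTerm_partial_fractions (n : ℕ) (t : ℝ) (ht : ∀ j : ℕ, t + j ≠ 0) :
    wpTerm n t = ∑ i ∈ Finset.range (n + 1), ∑ s ∈ Finset.Icc 1 6,
      (wpCoeff n s i : ℝ) / (t + i) ^ s := by
  have h := congrArg (Polynomial.eval₂ (algebraMap ℚ ℝ) t) (wpNumPoly_eq_sum n)
  have hQ : ∏ j ∈ Finset.range (n + 1), (t + (j : ℝ)) ^ 6 ≠ 0 :=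
    Finset.prod_ne_zero_iff.2 fun j _ => pow_ne_zero _ (ht j)
  have hN : Polynomial.eval₂ (algebraMap ℚ ℝ) t (wpNumPoly n) =
      (n.factorial : ℝ) ^ 4 * (t + (n : ℝ) / 2) * ((∏ j ∈ Finset.Icc 1 n, (t - (j : ℝ))) *
        ∏ j ∈ Finset.Icc 1 n, (t + (n : ℝ) + (j : ℝ))) := by
    rw [wpNumPoly]
    simp only [Polynomial.eval₂_mul, Polynomial.eval₂_add, Polynomial.eval₂_sub,
      Polynomial.eval₂_finsetProd, Polynomial.eval₂_C, Polynomial.eval₂_X, eq_ratCast]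
    push_cast
    simp only [add_assoc]
  rw [wpTerm, ← hN, h, Polynomial.eval₂_finsetSum, Finset.sum_div]
  refine Finset.sum_congr rfl fun i hi => ?_
  rw [Polynomial.eval₂_finsetSum, Finset.sum_div]
  refine Finset.sum_congr rfl fun s hs => ?_
  have hs' := Finset.mem_Icc.1 hs
  rw [← Finset.mul_prod_erase _ _ hi] at hQ ⊢
  have hc : ∏ j ∈ (Finset.range (n + 1)).erase i, (t + (j : ℝ)) ^ 6 ≠ 0 :=
    right_ne_zero_of_mul hQ
  simp only [wpCofactor, Polynomial.eval₂_mul, Polynomial.eval₂_add, Polynomial.eval₂_pow,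
    Polynomial.eval₂_finsetProd, Polynomial.eval₂_C, Polynomial.eval₂_X, eq_ratCast,
    Rat.cast_natCast]
  have hti := ht i
  rw [← mul_assoc, mul_div_mul_right _ _ hc, div_eq_div_iff (pow_ne_zero _ hti)
    (pow_ne_zero _ hti), mul_assoc, ← pow_add, Nat.sub_add_cancel hs'.2]

/-! ### Summation of the series -/

theorem wpCore_nonneg (n k : ℕ) : 0 ≤ wpCore n ((k : ℝ) + 1) := by
  unfold wpCore
  rcases Nat.lt_or_ge k n with h | h
  · have : ∏ j ∈ Finset.Icc 1 n, ((k : ℝ) + 1 - (j : ℝ)) = 0 :=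
      Finset.prod_eq_zero (Finset.mem_Icc.2 ⟨by omega, h⟩ : k + 1 ∈ Finset.Icc 1 n)
        (by push_cast; ring)
    rw [this]; simp
  · refine div_nonneg (mul_nonneg (by positivity) (mul_nonneg ?_ ?_)) ?_
    · refine Finset.prod_nonneg fun j hj => ?_
      have : (j : ℝ) ≤ k := by exact_mod_cast (Finset.mem_Icc.1 hj).2.trans h
      linarith
    · exact Finset.prod_nonneg fun j _ => by positivity
    · exact Finset.prod_nonneg fun j _ => by positivity

theorem wpCore_pos (n k : ℕ) (h : n ≤ k) : 0 < wpCore n ((k : ℝ) + 1) := by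
  unfold wpCore
  refine div_pos (mul_pos (by positivity) (mul_pos ?_ ?_)) ?_
  · refine Finset.prod_pos fun j hj => ?_
    have : (j : ℝ) ≤ k := by exact_mod_cast (Finset.mem_Icc.1 hj).2.trans h
    linarith
  · exact Finset.prod_pos fun j _ => by positivity
  · exact Finset.prod_pos fun j _ => by positivity

theorem wpTerm_nonneg (n k : ℕ) : 0 ≤ wpTerm n ((k : ℝ) + 1) := by
  rw [wpTerm_eq, wpFun]
  exact mul_nonneg (by positivity) (wpCore_nonneg n k)

theorem wpTerm_pos (n k : ℕ) (h : n ≤ k) : 0 < wpTerm n ((k : ℝ) + 1) := by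
  rw [wpTerm_eq, wpFun]
  exact mul_pos (by positivity) (wpCore_pos n k h)

/-- The polynomial inequality behind `wpTerm_succ_le`; the difference of both sides has nonnegative
coefficients. -/
theorem ratio_polynomial_bound (N z : ℝ) (hN : 0 ≤ N) (hz : 0 ≤ z) :
    40 * N ^ 4 * z * ((3 * N + 2 * z) * (3 * N + z)) ≤ (2 * N + z) ^ 7 := by
  have : (2 * N + z) ^ 7 - 40 * N ^ 4 * z * ((3 * N + 2 * z) * (3 * N + z)) =
      128 * N ^ 7 + 88 * N ^ 6 * z + 312 * N ^ 5 * z ^ 2 + 480 * N ^ 4 * z ^ 3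
        + 280 * N ^ 3 * z ^ 4 + 84 * N ^ 2 * z ^ 5 + 14 * N * z ^ 6 + z ^ 7 := by ring
  have h2 : 0 ≤ 128 * N ^ 7 + 88 * N ^ 6 * z + 312 * N ^ 5 * z ^ 2 + 480 * N ^ 4 * z ^ 3
        + 280 * N ^ 3 * z ^ 4 + 84 * N ^ 2 * z ^ 5 + 14 * N * z ^ 6 + z ^ 7 := by positivity
  linarith

/-- At the positive integers the summand decreases in `n` by a factor of at least `40`. -/
theorem wpTerm_succ_le (n k : ℕ) :
    wpTerm (n + 1) ((k : ℝ) + 1) ≤ wpTerm n ((k : ℝ) + 1) / 40 := by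
  rcases Nat.lt_or_ge k n with h | h
  · have e : ∀ m, n ≤ m → wpTerm m ((k : ℝ) + 1) = 0 := by
      intro m hm
      have : ∏ j ∈ Finset.Icc 1 m, ((k : ℝ) + 1 - (j : ℝ)) = 0 :=
        Finset.prod_eq_zero (Finset.mem_Icc.2 ⟨by omega, by omega⟩ : k + 1 ∈ Finset.Icc 1 m)
          (by push_cast; ring)
      rw [wpTerm, this]; simp
    rw [e n le_rfl, e (n + 1) (by omega)]; simp
  · have hk : (n : ℝ) ≤ k := by exact_mod_cast h
    have hn : (0 : ℝ) ≤ n := Nat.cast_nonneg n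
    have hc := wpCore_nonneg n k
    rw [wpTerm_eq, wpTerm_eq, wpFun, wpFun, wpCore_succ n _ (by positivity)]
    generalize wpCore n ((k : ℝ) + 1) = c at *
    push_cast
    obtain ⟨z, hz, hkz⟩ : ∃ z : ℝ, 0 ≤ z ∧ (k : ℝ) = n + z := ⟨k - n, by linarith, by ring⟩
    rw [hkz]
    obtain ⟨N, hN, hnN⟩ : ∃ N : ℝ, 1 ≤ N ∧ (n : ℝ) = N - 1 := ⟨n + 1, by linarith, by ring⟩
    rw [hnN]
    have e0 : N - 1 + z + 1 + (N - 1) + 1 = 2 * N + z := by ring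
    have e1 : N - 1 + z + 1 - (N - 1) - 1 = z := by ring
    rw [e0, e1]
    have hpos : 0 < (2 * N + z) ^ 7 := by positivity
    have key : (N - 1 + z + 1 + (N - 1 + 1) / 2) * ((N - 1 + 1) ^ 4 * z *
        ((N - 1 + z + 1 + 2 * (N - 1) + 1) * (N - 1 + z + 1 + 2 * (N - 1) + 2)) /
        (2 * N + z) ^ 7) ≤ (N - 1 + z + 1 + (N - 1) / 2) / 40 := by
      rw [← mul_div_assoc, div_le_iff₀ hpos]
      -- Here `n = N - 1` and `t = N + z`. As `3 N - 1 + z ≤ 3 N - 1 + 2 z`, the factor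
      -- `t + 2 n + 1` on the left is absorbed by the linear factor `2 t + n = 3 N - 1 + 2 z`
      -- on the right.
      have b := ratio_polynomial_bound N z (by linarith) hz
      have h3 : 0 ≤ 3 * N - 1 + 2 * z := by linarith
      have b2 := mul_le_mul_of_nonneg_left b h3
      have h4 : 0 ≤ N ^ 4 * z * ((3 * N + z) * (3 * N + 2 * z)) * z := by positivity
      nlinarith [b2, h4]
    calc _ = c * ((N - 1 + z + 1 + (N - 1 + 1) / 2) * ((N - 1 + 1) ^ 4 * z *
        ((N - 1 + z + 1 + 2 * (N - 1) + 1) * (N - 1 + z + 1 + 2 * (N - 1) + 2)) /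
        (2 * N + z) ^ 7)) := by ring
      _ ≤ c * ((N - 1 + z + 1 + (N - 1) / 2) / 40) := mul_le_mul_of_nonneg_left key hc
      _ = _ := by ring

/-- The value `ζ(s)` as a real series. It is meaningful for `1 < s` only, the sum being the junk
value `0` otherwise. -/
noncomputable def realZeta (s : ℕ) : ℝ := ∑' k : ℕ, 1 / ((k : ℝ) + 1) ^ s

theorem summable_one_div_succ_pow (s : ℕ) (hs : 1 < s) :
    Summable fun k : ℕ => 1 / ((k : ℝ) + 1) ^ s := by
  have := (summable_nat_add_iff 1).2 (Real.summable_one_div_nat_pow.2 hs)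
  simpa using this

theorem riemannZeta_eq_realZeta (s : ℕ) (hs : 1 < s) : riemannZeta s = (realZeta s : ℂ) := by
  rw [zeta_nat_eq_tsum_of_gt_one hs, realZeta, Complex.ofReal_tsum,
    Summable.tsum_eq_zero_add]
  · rw [Nat.cast_zero, zero_pow (by omega), div_zero, zero_add]
    refine tsum_congr fun k => ?_
    push_cast; rfl
  · exact Summable.of_norm (by simpa using Real.summable_one_div_nat_pow.2 hs)

theorem wpTerm_zero (t : ℝ) (ht : t ≠ 0) : wpTerm 0 t = 1 / t ^ 5 := by
  simp [wpTerm]; field_simp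

theorem summable_wpTerm (n : ℕ) : Summable fun k : ℕ => wpTerm n ((k : ℝ) + 1) := by
  induction n with
  | zero =>
    refine (summable_one_div_succ_pow 5 (by norm_num)).congr fun k => ?_
    rw [wpTerm_zero _ (by positivity)]
  | succ n ih =>
    exact Summable.of_nonneg_of_le (fun k => wpTerm_nonneg _ k) (fun k => wpTerm_succ_le n k)
      (ih.div_const 40)

theorem wpR_pos (n : ℕ) : 0 < wpR n :=
  (summable_wpTerm n).tsum_pos (fun k => wpTerm_nonneg n k) n (wpTerm_pos n n le_rfl)

theorem wpR_succ_le (n : ℕ) : wpR (n + 1) ≤ wpR n / 40 := by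
  unfold wpR
  rw [← tsum_div_const]
  exact (summable_wpTerm _).tsum_le_tsum (fun k => wpTerm_succ_le n k)
    ((summable_wpTerm n).div_const 40)

theorem wpR_zero : wpR 0 = realZeta 5 :=
  tsum_congr fun k => wpTerm_zero _ (by positivity)

theorem wpTerm_le (n k : ℕ) : wpTerm n ((k : ℝ) + 1) ≤ 1 / ((k : ℝ) + 1) ^ 5 := by
  induction n with
  | zero => exact (wpTerm_zero _ (by positivity)).le
  | succ n ih =>
    have := wpTerm_succ_le n k
    have := wpTerm_nonneg n k
    linarith

/-- The partial sum `∑_{l=1}^N l ^ (-s)`. -/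
noncomputable def zetaPartial (s N : ℕ) : ℝ := ∑ k ∈ Finset.range N, 1 / ((k : ℝ) + 1) ^ s

theorem zetaPartial_eq_sum_Icc (s N : ℕ) :
    zetaPartial s N = ∑ l ∈ Finset.Icc 1 N, 1 / (l : ℝ) ^ s := by
  rw [zetaPartial]
  induction N with
  | zero => simp
  | succ N ih =>
    rw [Finset.sum_range_succ, ih, Finset.sum_Icc_succ_top (by omega)]
    push_cast; rfl

theorem sum_range_shifted (s i N : ℕ) :
    ∑ k ∈ Finset.range N, 1 / ((k : ℝ) + 1 + i) ^ s = zetaPartial s (i + N) - zetaPartial s i := by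
  rw [zetaPartial, zetaPartial, Finset.sum_range_add_sub_sum_range]
  refine Finset.sum_congr rfl fun k _ => ?_
  push_cast; ring_nf

theorem tendsto_zetaPartial (s i : ℕ) (hs : 1 < s) :
    Tendsto (fun N => zetaPartial s (i + N)) atTop (𝓝 (realZeta s)) := by
  have := (summable_one_div_succ_pow s hs).hasSum.tendsto_sum_nat
  exact this.comp (tendsto_add_atTop_nat i |>.congr fun N => add_comm N i)

/-- Shifts of the harmonic numbers have the same asymptotics. This replaces the convergence of the
partial sums, which fails for `s = 1`. -/
theorem tendsto_zetaPartial_one_sub (i : ℕ) :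
    Tendsto (fun N => zetaPartial 1 (i + N) - zetaPartial 1 N) atTop (𝓝 0) := by
  have e : ∀ N, zetaPartial 1 (i + N) - zetaPartial 1 N =
      ∑ l ∈ Finset.range i, 1 / ((N : ℝ) + ((l : ℝ) + 1)) := by
    intro N
    rw [zetaPartial, zetaPartial, add_comm i N, Finset.sum_range_add, add_sub_cancel_left]
    refine Finset.sum_congr rfl fun k _ => ?_
    push_cast; ring_nf
  simp only [e]
  rw [← Finset.sum_const_zero (s := Finset.range i)]
  refine tendsto_finsetSum _ fun l _ => ?_
  have h : Tendsto (fun N : ℕ => (N : ℝ) + ((l : ℝ) + 1)) atTop atTop :=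
    tendsto_atTop_add_const_right _ _ tendsto_natCast_atTop_atTop
  simp only [one_div]
  exact h.inv_tendsto_atTop

theorem tendsto_sum_wpCoeff_mul_zetaPartial (n s : ℕ) (hs : 1 < s) :
    Tendsto (fun N => ∑ i ∈ Finset.range (n + 1), (wpCoeff n s i : ℝ) * zetaPartial s (i + N))
      atTop (𝓝 ((wpSum s n : ℝ) * realZeta s)) := by
  rw [wpSum, Rat.cast_sum, Finset.sum_mul]
  exact tendsto_finsetSum _ fun i _ => (tendsto_zetaPartial s i hs).const_mul _

theorem tendsto_sum_wpCoeff_one_mul_zetaPartial (n : ℕ) :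
    Tendsto (fun N => ∑ i ∈ Finset.range (n + 1), (wpCoeff n 1 i : ℝ) * zetaPartial 1 (i + N))
      atTop (𝓝 0) := by
  have e : ∀ N, ∑ i ∈ Finset.range (n + 1), (wpCoeff n 1 i : ℝ) * zetaPartial 1 (i + N) =
      ∑ i ∈ Finset.range (n + 1),
        (wpCoeff n 1 i : ℝ) * (zetaPartial 1 (i + N) - zetaPartial 1 N) := by
    intro N
    have h : (∑ i ∈ Finset.range (n + 1), (wpCoeff n 1 i : ℝ)) * zetaPartial 1 N = 0 := by
      rw [← Rat.cast_sum, show ∑ i ∈ Finset.range (n + 1), wpCoeff n 1 i = 0 from wpSum_order_one n]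
      simp
    simp only [mul_sub, Finset.sum_sub_distrib, ← Finset.sum_mul, h, sub_zero]
  simp only [e]
  rw [← Finset.sum_const_zero (s := Finset.range (n + 1))]
  refine tendsto_finsetSum _ fun i _ => ?_
  simpa using (tendsto_zetaPartial_one_sub i).const_mul (wpCoeff n 1 i : ℝ)

theorem wpU_eq_wpSum (n : ℕ) : wpU n = wpSum 5 n := rfl

theorem wpW_eq_wpSum (n : ℕ) : wpW n = wpSum 3 n := rfl

/-- Summation of the partial fraction decomposition over `t = 1, 2, …`. -/
theorem wpR_eq (n : ℕ) :
    wpR n = (wpU n : ℝ) * realZeta 5 + (wpW n : ℝ) * realZeta 3 - (wpV n : ℝ) := by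
  have h1 := (summable_wpTerm n).hasSum.tendsto_sum_nat
  have e : ∀ N, ∑ k ∈ Finset.range N, wpTerm n ((k : ℝ) + 1) =
      ∑ s ∈ Finset.Icc 1 6, (∑ i ∈ Finset.range (n + 1),
        (wpCoeff n s i : ℝ) * zetaPartial s (i + N)) - (wpV n : ℝ) := by
    intro N
    have hv : (wpV n : ℝ) = ∑ s ∈ Finset.Icc 1 6, ∑ i ∈ Finset.range (n + 1),
        (wpCoeff n s i : ℝ) * zetaPartial s i := by
      simp only [zetaPartial_eq_sum_Icc, wpV]
      push_cast; rfl
    rw [hv, ← Finset.sum_sub_distrib]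
    simp only [← Finset.sum_sub_distrib, ← mul_sub, ← sum_range_shifted]
    rw [Finset.sum_congr rfl fun (k : ℕ) _ => wpTerm_partial_fractions n ((k : ℝ) + 1)
      fun j => by positivity, Finset.sum_comm, Finset.sum_comm (s := Finset.Icc 1 6)]
    refine Finset.sum_congr rfl fun i _ => ?_
    rw [Finset.sum_comm]
    refine Finset.sum_congr rfl fun s _ => ?_
    rw [Finset.mul_sum]
    refine Finset.sum_congr rfl fun k _ => ?_
    rw [mul_one_div]
  simp only [e] at h1
  have h2 : Tendsto (fun N => ∑ s ∈ Finset.Icc 1 6, (∑ i ∈ Finset.range (n + 1),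
      (wpCoeff n s i : ℝ) * zetaPartial s (i + N)) - (wpV n : ℝ)) atTop
      (𝓝 (∑ s ∈ Finset.Icc 1 6, (wpSum s n : ℝ) * realZeta s - (wpV n : ℝ))) := by
    refine (tendsto_finsetSum _ fun s hs => ?_).sub_const _
    rcases eq_or_lt_of_le (Finset.mem_Icc.1 hs).1 with h | h
    -- The junk value `realZeta 1` is multiplied by zero.
    · rw [← h, wpSum_order_one, Rat.cast_zero, zero_mul]
      exact tendsto_sum_wpCoeff_one_mul_zetaPartial n
    · exact tendsto_sum_wpCoeff_mul_zetaPartial n s h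
  have h3 := tendsto_nhds_unique h1 h2
  have e6 : ∑ s ∈ Finset.Icc 1 6, (wpSum s n : ℝ) * realZeta s =
      (wpSum 5 n : ℝ) * realZeta 5 + (wpSum 3 n : ℝ) * realZeta 3 := by
    rw [show Finset.Icc 1 6 = ({1, 2, 3, 4, 5, 6} : Finset ℕ) by decide]
    simp [wpSum_order_one, wpSum_eq_zero_of_even n 2 (by norm_num) (by decide),
      wpSum_eq_zero_of_even n 4 (by norm_num) (by decide),
      wpSum_eq_zero_of_even n 6 (by norm_num) (by decide)]
    ring
  rw [wpR, h3, e6]; rfl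

theorem wpTel_at_one (m : ℕ) : wpTel m (1 : ℝ) = 0 := by
  rcases Nat.eq_zero_or_pos m with h | h
  -- For `m = 0` there is no zero in `wpCore`; the factor `t - m - 1` vanishes instead.
  · subst h; simp [wpTel]
  · have : wpCore m (1 : ℝ) = 0 := by
      have : ∏ j ∈ Finset.Icc 1 m, ((1 : ℝ) - (j : ℝ)) = 0 :=
        Finset.prod_eq_zero (Finset.mem_Icc.2 ⟨le_rfl, h⟩ : 1 ∈ Finset.Icc 1 m) (by simp)
      rw [wpCore, this]; simp
    rw [wpTel, this]; simp

/-- Growth of order at most `t ^ 15`, for fixed `n`. -/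
theorem exists_telPoly_bound (n : ℝ) :
    ∃ C : ℝ, 0 ≤ C ∧ ∀ t : ℝ, 1 ≤ t → |telPoly n t| ≤ C * t ^ 15 := by
  obtain ⟨c, hc⟩ : ∃ c : ℕ → ℝ, ∀ t : ℝ, telPoly n t = ∑ k ∈ Finset.range 16, c k * t ^ k := by
    refine ⟨fun k => match k with
      | 0 => telCoeff0 n | 1 => telCoeff1 n | 2 => telCoeff2 n | 3 => telCoeff3 n
      | 4 => telCoeff4 n | 5 => telCoeff5 n | 6 => telCoeff6 n | 7 => telCoeff7 n
      | 8 => telCoeff8 n | 9 => telCoeff9 n | 10 => telCoeff10 n | 11 => telCoeff11 n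
      | 12 => telCoeff12 n | 13 => telCoeff13 n | 14 => telCoeff14 n | _ => telCoeff15 n,
      fun t => ?_⟩
    simp only [Finset.sum_range_succ, Finset.sum_range_zero, telPoly]
    ring
  refine ⟨∑ k ∈ Finset.range 16, |c k|, Finset.sum_nonneg fun _ _ => abs_nonneg _, fun t ht => ?_⟩
  rw [hc, Finset.sum_mul]
  refine (Finset.abs_sum_le_sum_abs _ _).trans (Finset.sum_le_sum fun k hk => ?_)
  rw [abs_mul, abs_of_nonneg (by positivity : (0 : ℝ) ≤ t ^ k)]
  have := Finset.mem_range.1 hk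
  exact mul_le_mul_of_nonneg_left (pow_le_pow_right₀ ht (by omega)) (abs_nonneg _)

theorem tendsto_wpTel (m : ℕ) :
    Tendsto (fun k : ℕ => wpTel m ((k : ℝ) + 1)) atTop (𝓝 0) := by
  obtain ⟨C, hC, hb⟩ := exists_telPoly_bound ((m : ℝ) + 2)
  have hlim : Tendsto (fun k : ℕ => (C * (m + 2)) * (1 / ((k : ℝ) + 1))) atTop (𝓝 0) := by
    simpa using (tendsto_one_div_add_atTop_nhds_zero_nat (𝕜 := ℝ)).const_mul (C * (m + 2))
  refine squeeze_zero_norm (fun k => ?_) hlim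
  have hcore := wpTerm_le m k
  rw [wpTerm_eq, wpFun] at hcore
  have hc0 := wpCore_nonneg m k
  have hy := hb ((k : ℝ) + 1) (by linarith [(Nat.cast_nonneg k : (0 : ℝ) ≤ k)])
  have hm : (0 : ℝ) ≤ m := Nat.cast_nonneg m
  obtain ⟨t, ht, hkt⟩ : ∃ t : ℝ, 1 ≤ t ∧ (k : ℝ) + 1 = t :=
    ⟨k + 1, by linarith [(Nat.cast_nonneg k : (0 : ℝ) ≤ k)], rfl⟩
  rw [hkt] at hcore hc0 hy ⊢
  have ht0 : 0 < t := by linarith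
  have hcore' : t * wpCore m t ≤ 1 / t ^ 5 := by
    nlinarith [mul_nonneg (by positivity : (0 : ℝ) ≤ m / 2) hc0]
  have hlin : |t - m - 1| ≤ (m + 2) * t := by
    rw [abs_le]; constructor <;> nlinarith
  have hden : t ^ 14 ≤ 2 * ((t + m + 1) * (t + m + 2)) ^ 7 := by
    have : t ^ 2 ≤ (t + m + 1) * (t + m + 2) := by nlinarith
    calc t ^ 14 = (t ^ 2) ^ 7 := by ring
      _ ≤ ((t + m + 1) * (t + m + 2)) ^ 7 := pow_le_pow_left₀ (by positivity) this 7
      _ ≤ _ := by nlinarith [pow_nonneg (by positivity : 0 ≤ (t + m + 1) * (t + m + 2)) 7]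
  rw [wpTel, Real.norm_eq_abs, abs_div, abs_mul, abs_mul, abs_of_nonneg hc0,
    abs_of_nonneg (by positivity : 0 ≤ 2 * ((t + m + 1) * (t + m + 2)) ^ 7)]
  calc wpCore m t * |t - m - 1| * |telPoly ((m : ℝ) + 2) t| /
        (2 * ((t + m + 1) * (t + m + 2)) ^ 7)
      ≤ wpCore m t * ((m + 2) * t) * (C * t ^ 15) / t ^ 14 := by gcongr
    _ = C * (m + 2) * (t * wpCore m t) * t := by field_simp
    _ ≤ C * (m + 2) * (1 / t ^ 5) * t := by gcongr
    _ = C * (m + 2) * (1 / t) * (1 / t ^ 3) := by field_simp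
    _ ≤ C * (m + 2) * (1 / t) * 1 := by
        gcongr
        rw [div_le_one (by positivity)]
        exact one_le_pow₀ ht
    _ = _ := by ring

theorem wpR_recursion (m : ℕ) :
    ((m : ℝ) + 2) * (m + 3) ^ 5 * recB0 ((m : ℝ) + 1) * wpR (m + 3)
      - 2 * (m + 2) * recB1 ((m : ℝ) + 2) * wpR (m + 2)
      - recB2 ((m : ℝ) + 2) * wpR (m + 1)
      + 2 * (m + 1) ^ 5 * (2 * m + 3) * recB0 ((m : ℝ) + 2) * wpR m = 0 := by
  have hs := fun n => (summable_wpTerm n).hasSum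
  have h := ((((hs (m + 3)).mul_left (((m : ℝ) + 2) * (m + 3) ^ 5 * recB0 ((m : ℝ) + 1))).sub
    ((hs (m + 2)).mul_left (2 * (m + 2) * recB1 ((m : ℝ) + 2)))).sub
    ((hs (m + 1)).mul_left (recB2 ((m : ℝ) + 2)))).add
    ((hs m).mul_left (2 * (m + 1) ^ 5 * (2 * m + 3) * recB0 ((m : ℝ) + 2)))
  have e : ∀ k : ℕ, _ = _ := fun k => wpFun_telescope m ((k : ℝ) + 1) (by positivity)
    (by positivity) (by positivity) (by positivity)
  simp only [wpTerm_eq, e] at h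
  have h1 := h.tendsto_sum_nat
  have h2 : ∀ N : ℕ, ∑ k ∈ Finset.range N, (wpTel m ((k : ℝ) + 1 + 1) - wpTel m ((k : ℝ) + 1)) =
      wpTel m ((N : ℝ) + 1) := by
    intro N
    have := Finset.sum_range_sub (fun k : ℕ => wpTel m ((k : ℝ) + 1)) N
    push_cast at this
    rw [this, zero_add, wpTel_at_one, sub_zero]
  simp only [h2] at h1
  have h3 := tendsto_nhds_unique h1 (tendsto_wpTel m)
  simpa only [wpR, wpTerm_eq] using h3

/-! ### Initial values -/

/-- Low coefficients of a power series quotient `E = N / D` can be read off a polynomial `Q` with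
`c N ≡ Q D` modulo a power of `X`. The factor `c` clears the denominators of `Q`. -/
theorem coeff_eq_of_mul_eq_add_X_pow_mul (k : ℕ) (E D Q H : ℚ⟦X⟧) (c : ℚ)
    (hD : PowerSeries.constantCoeff D ≠ 0)
    (h : PowerSeries.C c * (E * D) = Q * D + PowerSeries.X ^ (k + 1) * H) :
    c * PowerSeries.coeff k E = PowerSeries.coeff k Q := by
  have hinv := PowerSeries.mul_inv_cancel D hD
  have h2 : PowerSeries.C c * E = Q + PowerSeries.X ^ (k + 1) * (H * D⁻¹) := by
    linear_combination D⁻¹ * h + (Q - PowerSeries.C c * E) * hinv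
  have h3 := congrArg (PowerSeries.coeff k) h2
  rw [PowerSeries.coeff_C_mul, map_add, PowerSeries.coeff_X_pow_mul', if_neg (by omega),
    add_zero] at h3
  exact h3

theorem wpCoeff_zero (s : ℕ) : wpCoeff 0 s 0 = PowerSeries.coeff (6 - s) PowerSeries.X := by
  simp [wpCoeff, wpExpansion]

theorem wpU_zero : wpU 0 = 1 := by
  simp [wpU, wpCoeff_zero]

theorem wpW_zero : wpW 0 = 0 := by
  simp [wpW, wpCoeff_zero, PowerSeries.coeff_X]

theorem wpLocalDen_one_zero : wpLocalDen 1 0 = (PowerSeries.X + 1) ^ 6 := by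
  rw [wpLocalDen, show (Finset.range (1 + 1)).erase 0 = {1} by decide]
  simp

theorem wpLocalDen_two_zero :
    wpLocalDen 2 0 = ((PowerSeries.X + 1) * (PowerSeries.X + 2)) ^ 6 := by
  rw [wpLocalDen, show (Finset.range (2 + 1)).erase 0 = {1, 2} by decide]
  simp [mul_pow]

theorem wpLocalDen_two_one :
    wpLocalDen 2 1 = ((PowerSeries.X - 1) * (PowerSeries.X + 1)) ^ 6 := by
  rw [wpLocalDen, show (Finset.range (2 + 1)).erase 1 = {0, 2} by decide, mul_pow,
    Finset.prod_insert (by decide), Finset.prod_singleton]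
  norm_num
  left
  ring

theorem coeff_wpExpansion_one_zero (k : ℕ) (hk : k ≤ 3) :
    2 * PowerSeries.coeff k (wpExpansion 1 0) =
      PowerSeries.coeff k (PowerSeries.C (-2 : ℚ) + PowerSeries.C 9 * PowerSeries.X
        + PowerSeries.C (-21) * PowerSeries.X ^ 2 + PowerSeries.C 33 * PowerSeries.X ^ 3) := by
  refine coeff_eq_of_mul_eq_add_X_pow_mul k _ (wpLocalDen 1 0) _
    (PowerSeries.X ^ (3 - k) * (-33 - 198 * PowerSeries.X - 397 * PowerSeries.X ^ 2
      - 378 * PowerSeries.X ^ 3 - 177 * PowerSeries.X ^ 4 - 33 * PowerSeries.X ^ 5)) 2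
    (constantCoeff_wpLocalDen 1 0) ?_
  rw [← mul_assoc (PowerSeries.X ^ (k + 1)), ← pow_add, show k + 1 + (3 - k) = 4 by omega,
    wpExpansion_mul_wpLocalDen, wpLocalDen_one_zero]
  simp only [show Finset.Icc 1 1 = ({1} : Finset ℕ) by decide, Finset.prod_singleton]
  have h : PowerSeries.C (1 / 2 : ℚ) * 2 = 1 := by
    rw [← map_ofNat (PowerSeries.C (R := ℚ)) 2, ← map_mul]; norm_num
  norm_num [map_ofNat]
  linear_combination ((PowerSeries.X - 1) * (PowerSeries.X + 2)) * h

theorem coeff_wpExpansion_two_zero (k : ℕ) (hk : k ≤ 3) :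
    8 * PowerSeries.coeff k (wpExpansion 2 0) =
      PowerSeries.coeff k (PowerSeries.C (48 : ℚ) + PowerSeries.C (-428) * PowerSeries.X
        + PowerSeries.C 2030 * PowerSeries.X ^ 2 + PowerSeries.C (-6867) * PowerSeries.X ^ 3) := by
  refine coeff_eq_of_mul_eq_add_X_pow_mul k _ (wpLocalDen 2 0) _
    (PowerSeries.X ^ (3 - k) * (1194592 + 7970144 * PowerSeries.X + 24637656 * PowerSeries.X ^ 2
      + 46277288 * PowerSeries.X ^ 3 + 58369006 * PowerSeries.X ^ 4 + 51702303 * PowerSeries.X ^ 5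
      + 32725860 * PowerSeries.X ^ 6 + 14772237 * PowerSeries.X ^ 7 + 4653486 * PowerSeries.X ^ 8
      + 973337 * PowerSeries.X ^ 9 + 121576 * PowerSeries.X ^ 10 + 6867 * PowerSeries.X ^ 11)) 8
    (constantCoeff_wpLocalDen 2 0) ?_
  rw [← mul_assoc (PowerSeries.X ^ (k + 1)), ← pow_add, show k + 1 + (3 - k) = 4 by omega,
    wpExpansion_mul_wpLocalDen, wpLocalDen_two_zero]
  simp only [show Finset.Icc 1 2 = ({1, 2} : Finset ℕ) by decide,
    Finset.prod_insert (show 1 ∉ ({2} : Finset ℕ) by decide), Finset.prod_singleton]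
  norm_num [map_ofNat]
  ring

theorem coeff_wpExpansion_two_one (k : ℕ) (hk : k ≤ 3) :
    1 * PowerSeries.coeff k (wpExpansion 2 1) =
      PowerSeries.coeff k (PowerSeries.C (576 : ℚ) * PowerSeries.X
        + PowerSeries.C 3248 * PowerSeries.X ^ 3) := by
  refine coeff_eq_of_mul_eq_add_X_pow_mul k _ (wpLocalDen 2 1) _
    (PowerSeries.X ^ (3 - k) * (10864 * PowerSeries.X - 37200 * PowerSeries.X ^ 3
      + 56320 * PowerSeries.X ^ 5 - 45264 * PowerSeries.X ^ 7 + 18912 * PowerSeries.X ^ 9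
      - 3248 * PowerSeries.X ^ 11)) 1
    (constantCoeff_wpLocalDen 2 1) ?_
  rw [← mul_assoc (PowerSeries.X ^ (k + 1)), ← pow_add, show k + 1 + (3 - k) = 4 by omega,
    wpExpansion_mul_wpLocalDen, wpLocalDen_two_one]
  simp only [show Finset.Icc 1 2 = ({1, 2} : Finset ℕ) by decide,
    Finset.prod_insert (show 1 ∉ ({2} : Finset ℕ) by decide), Finset.prod_singleton]
  norm_num [map_ofNat]
  ring

theorem wpCoeff_reflect_of_odd (n s i : ℕ) (hs : s ≤ 6) (hi : i ≤ n) (ho : Odd s) :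
    wpCoeff n s (n - i) = wpCoeff n s i := by
  rw [wpCoeff_reflect n s i hs hi, ho.neg_one_pow]; ring

theorem wpSum_at_one (s : ℕ) (hs : s ≤ 6) (ho : Odd s) : wpSum s 1 = 2 * wpCoeff 1 s 0 := by
  have := wpCoeff_reflect_of_odd 1 s 0 hs (by omega) ho
  rw [wpSum, Finset.sum_range_succ, Finset.sum_range_one]
  simp only [Nat.sub_zero] at this
  rw [this]; ring

theorem wpSum_at_two (s : ℕ) (hs : s ≤ 6) (ho : Odd s) :
    wpSum s 2 = 2 * wpCoeff 2 s 0 + wpCoeff 2 s 1 := by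
  have := wpCoeff_reflect_of_odd 2 s 0 hs (by omega) ho
  rw [wpSum, Finset.sum_range_succ, Finset.sum_range_succ, Finset.sum_range_one]
  simp only [Nat.sub_zero] at this
  rw [this]; ring

theorem wpU_one : wpU 1 = 9 := by
  have h := coeff_wpExpansion_one_zero 1 (by norm_num)
  simp only [map_add, PowerSeries.coeff_C_mul, PowerSeries.coeff_X_pow, PowerSeries.coeff_C,
    PowerSeries.coeff_X] at h
  rw [wpU_eq_wpSum, wpSum_at_one 5 (by norm_num) (by decide), wpCoeff, h]
  norm_num

theorem wpW_one : wpW 1 = 33 := by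
  have h := coeff_wpExpansion_one_zero 3 (by norm_num)
  simp only [map_add, PowerSeries.coeff_C_mul, PowerSeries.coeff_X_pow, PowerSeries.coeff_C,
    PowerSeries.coeff_X] at h
  rw [wpW_eq_wpSum, wpSum_at_one 3 (by norm_num) (by decide), wpCoeff, h]
  norm_num

theorem wpU_two : wpU 2 = 469 := by
  have h0 := coeff_wpExpansion_two_zero 1 (by norm_num)
  have h1 := coeff_wpExpansion_two_one 1 (by norm_num)
  simp only [map_add, PowerSeries.coeff_C_mul, PowerSeries.coeff_X_pow, PowerSeries.coeff_C,
    PowerSeries.coeff_X] at h0 h1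
  rw [wpU_eq_wpSum, wpSum_at_two 5 (by norm_num) (by decide), wpCoeff, wpCoeff]
  norm_num at h0 h1 ⊢
  linarith

theorem wpW_two : wpW 2 = 6125 / 4 := by
  have h0 := coeff_wpExpansion_two_zero 3 (by norm_num)
  have h1 := coeff_wpExpansion_two_one 3 (by norm_num)
  simp only [map_add, PowerSeries.coeff_C_mul, PowerSeries.coeff_X_pow, PowerSeries.coeff_C,
    PowerSeries.coeff_X] at h0 h1
  rw [wpW_eq_wpSum, wpSum_at_two 3 (by norm_num) (by decide), wpCoeff, wpCoeff]
  norm_num at h0 h1 ⊢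
  linarith

/-! ### Recursions with convergent coefficients -/

/-- The coefficient of `x_{m+3}` in the recursion with `n = m + 2`. -/
def recC3 (m : ℝ) : ℝ := (m + 2) * (m + 3) ^ 5 * recB0 (m + 1)

/-- The coefficient of `x_{m+2}`, on the other side of the recursion. -/
def recC2 (m : ℝ) : ℝ := 2 * (m + 2) * recB1 (m + 2)

/-- The coefficient of `x_{m+1}`, on the other side of the recursion. -/
def recC1 (m : ℝ) : ℝ := recB2 (m + 2)

/-- The coefficient of `x_m`, with its sign reversed on the other side of the recursion. -/
def recC0 (m : ℝ) : ℝ := 2 * (m + 1) ^ 5 * (2 * m + 3) * recB0 (m + 2)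

/-- The recursion solved for its top term and indexed by `m = n - 2`, which avoids truncated
subtraction of indices. -/
def ShiftedRecursion (x : ℕ → ℝ) : Prop :=
  ∀ m : ℕ, recC3 m * x (m + 3) = recC2 m * x (m + 2) + recC1 m * x (m + 1) - recC0 m * x m

theorem ShiftedRecursion.satisfiesRecursion {x : ℕ → ℝ} (h : ShiftedRecursion x) :
    SatisfiesRecursion x := by
  intro n hn
  obtain ⟨m, rfl⟩ : ∃ m, n = m + 2 := ⟨n - 2, by omega⟩
  have := h m
  simp only [recC3, recC2, recC1, recC0] at this
  rw [polyB0_eq, polyB0_eq, polyB1_eq, polyB2_eq, show m + 2 + 1 = m + 3 by omega,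
    show m + 2 - 1 = m + 1 by omega, show m + 2 - 2 = m by omega]
  push_cast
  rw [show (m : ℝ) + 2 - 1 = m + 1 by ring, show (m : ℝ) + 2 + 1 = m + 3 by ring]
  linear_combination this

theorem recC3_pos (m : ℕ) : 0 < recC3 m := by
  unfold recC3 recB0; positivity

theorem recC0_pos (m : ℕ) : 0 < recC0 m := by
  unfold recC0 recB0; positivity

theorem recC3_le_recC2 (m : ℕ) : recC3 m ≤ recC2 m := by
  have h : recC2 m - recC3 m = 7707766 * (m : ℝ) ^ 9 + 143844693 * m ^ 8 + 1185225205 * m ^ 7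
      + 5656387648 * m ^ 6 + 17222722914 * m ^ 5 + 34681016141 * m ^ 4 + 46168033275 * m ^ 3
      + 39167304810 * m ^ 2 + 19211233492 * m + 4150540488 := by
    unfold recC2 recC3 recB0 recB1; ring
  have : 0 ≤ recC2 m - recC3 m := by rw [h]; positivity
  linarith

theorem recC0_le_recC1 (m : ℕ) : recC0 m ≤ recC1 m := by
  have h : recC1 m - recC0 m = 97439352 * (m : ℝ) ^ 9 + 1576559536 * m ^ 8 + 11264616354 * m ^ 7
      + 46658319022 * m ^ 6 + 123494237670 * m ^ 5 + 216661674456 * m ^ 4 + 252038055144 * m ^ 3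
      + 187517775902 * m ^ 2 + 80994291132 * m + 15479031704 := by
    unfold recC1 recC0 recB0 recB2; ring
  have : 0 ≤ recC1 m - recC0 m := by rw [h]; positivity
  linarith

/-- The limit of a polynomial of degree `9`, divided by `m ^ 9`; here `F` is the reversed
polynomial. -/
theorem tendsto_div_pow_nine (c F : ℝ → ℝ) (hF : Continuous F)
    (h : ∀ m : ℝ, m ≠ 0 → c m = m ^ 9 * F (1 / m)) :
    Tendsto (fun m : ℕ => c m / (m : ℝ) ^ 9) atTop (𝓝 (F 0)) := by
  have h1 : Tendsto (fun m : ℕ => F (1 / (m : ℝ))) atTop (𝓝 (F 0)) :=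
    (hF.tendsto 0).comp tendsto_one_div_atTop_nhds_zero_nat
  refine h1.congr' ?_
  filter_upwards [eventually_ne_atTop 0] with m hm
  have hm' : (m : ℝ) ≠ 0 := by exact_mod_cast hm
  rw [h m hm', mul_div_cancel_left₀ _ (pow_ne_zero _ hm')]

theorem tendsto_recC3 : Tendsto (fun m : ℕ => recC3 m / (m : ℝ) ^ 9) atTop (𝓝 41218) := by
  have := tendsto_div_pow_nine recC3 (fun z => (1 + 2 * z) * (1 + 3 * z) ^ 5 *
    (41218 * (1 + z) ^ 3 + 48459 * (1 + z) ^ 2 * z + 20010 * (1 + z) * z ^ 2 + 2871 * z ^ 3))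
    (by fun_prop) (fun m hm => by unfold recC3 recB0; field_simp)
  simpa using this

theorem tendsto_recC2 : Tendsto (fun m : ℕ => recC2 m / (m : ℝ) ^ 9) atTop (𝓝 7748984) := by
  have := tendsto_div_pow_nine recC2 (fun z => 2 * (1 + 2 * z) *
    (3874492 * (1 + 2 * z) ^ 8 + 2617900 * (1 + 2 * z) ^ 7 * z - 3144314 * (1 + 2 * z) ^ 6 * z ^ 2
      - 2947148 * (1 + 2 * z) ^ 5 * z ^ 3 + 647130 * (1 + 2 * z) ^ 4 * z ^ 4
      + 1182926 * (1 + 2 * z) ^ 3 * z ^ 5 + 115771 * (1 + 2 * z) ^ 2 * z ^ 6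
      - 170716 * (1 + 2 * z) * z ^ 7 - 44541 * z ^ 8))
    (by fun_prop) (fun m hm => by unfold recC2 recB1; field_simp)
  norm_num at this
  exact this

theorem tendsto_recC1 : Tendsto (fun m : ℕ => recC1 m / (m : ℝ) ^ 9) atTop (𝓝 97604224) := by
  have := tendsto_div_pow_nine recC1 (fun z =>
    2 * (48802112 * (1 + 2 * z) ^ 9 - 89030880 * (1 + 2 * z) ^ 8 * z
      + 36002654 * (1 + 2 * z) ^ 7 * z ^ 2 + 24317344 * (1 + 2 * z) ^ 6 * z ^ 3
      - 19538418 * (1 + 2 * z) ^ 5 * z ^ 4 - 1311365 * (1 + 2 * z) ^ 4 * z ^ 5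
      + 3790503 * (1 + 2 * z) ^ 3 * z ^ 6 - 460056 * (1 + 2 * z) ^ 2 * z ^ 7
      - 271701 * (1 + 2 * z) * z ^ 8 + 60291 * z ^ 9))
    (by fun_prop) (fun m hm => by unfold recC1 recB2; field_simp)
  norm_num at this
  exact this

theorem tendsto_recC0 : Tendsto (fun m : ℕ => recC0 m / (m : ℝ) ^ 9) atTop (𝓝 164872) := by
  have := tendsto_div_pow_nine recC0 (fun z => 2 * (1 + z) ^ 5 * (2 + 3 * z) *
    (41218 * (1 + 2 * z) ^ 3 + 48459 * (1 + 2 * z) ^ 2 * z + 20010 * (1 + 2 * z) * z ^ 2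
      + 2871 * z ^ 3))
    (by fun_prop) (fun m hm => by unfold recC0 recB0; field_simp)
  norm_num at this
  exact this

theorem tendsto_div_of_tendsto_div_pow {a b : ℕ → ℝ} {A B : ℝ} (k : ℕ) (hB : B ≠ 0)
    (ha : Tendsto (fun m : ℕ => a m / (m : ℝ) ^ k) atTop (𝓝 A))
    (hb : Tendsto (fun m : ℕ => b m / (m : ℝ) ^ k) atTop (𝓝 B)) :
    Tendsto (fun m : ℕ => a m / b m) atTop (𝓝 (A / B)) := by
  refine (ha.div hb hB).congr' ?_
  filter_upwards [eventually_ne_atTop 0] with m hm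
  have hm' : (m : ℝ) ≠ 0 := by exact_mod_cast hm
  exact div_div_div_cancel_right₀ (pow_ne_zero _ hm') _ _

theorem ShiftedRecursion.nonneg_and_le_succ {x : ℕ → ℝ} (h : ShiftedRecursion x) (h0 : 0 ≤ x 0)
    (h1 : x 0 ≤ x 1) (h2 : x 1 ≤ x 2) (m : ℕ) : 0 ≤ x m ∧ x m ≤ x (m + 1) := by
  have key : ∀ m, 0 ≤ x m ∧ x m ≤ x (m + 1) ∧ x (m + 1) ≤ x (m + 2) := by
    intro m
    induction m with
    | zero => exact ⟨h0, h1, h2⟩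
    | succ m ih =>
      obtain ⟨a0, a1, a2⟩ := ih
      refine ⟨a0.trans a1, a2, ?_⟩
      have hr := h m
      have b1 := mul_le_mul_of_nonneg_right (recC0_le_recC1 m) (a0.trans a1)
      have b2 := mul_le_mul_of_nonneg_left a1 (recC0_pos m).le
      have b3 := mul_le_mul_of_nonneg_right (recC3_le_recC2 m) ((a0.trans a1).trans a2)
      have : recC3 m * x (m + 2) ≤ recC3 m * x (m + 3) := by linarith
      exact le_of_mul_le_mul_left this (recC3_pos m)
  exact ⟨(key m).1, (key m).2.1⟩

theorem ShiftedRecursion.pos {x : ℕ → ℝ} (h : ShiftedRecursion x) (h0 : 0 ≤ x 0)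
    (h1 : x 0 ≤ x 1) (h2 : x 1 ≤ x 2) (hp : 0 < x 1) (n : ℕ) (hn : 1 ≤ n) : 0 < x n := by
  induction n, hn using Nat.le_induction with
  | base => exact hp
  | succ n _ ih => exact ih.trans_le (h.nonneg_and_le_succ h0 h1 h2 n).2

/-- A bounded sequence tends to zero if each eventual bound can be replaced by its half, up to an
arbitrarily small error. -/
theorem tendsto_zero_of_eventual_halving {d : ℕ → ℝ} (hd : ∀ n, 0 ≤ d n) {D₀ : ℝ} (hD₀ : 0 ≤ D₀)
    (hbound : ∀ᶠ n in atTop, d n ≤ D₀)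
    (hstep : ∀ D : ℝ, 0 ≤ D → (∀ᶠ n in atTop, d n ≤ D) → ∀ ε : ℝ, 0 < ε →
      ∀ᶠ n in atTop, d n ≤ D / 2 + ε) :
    Tendsto d atTop (𝓝 0) := by
  have key : ∀ ε : ℝ, 0 < ε → ∀ k : ℕ, ∀ᶠ n in atTop, d n ≤ D₀ * (1 / 2) ^ k + 2 * ε := by
    intro ε hε k
    induction k with
    | zero => filter_upwards [hbound] with n hn; simp; linarith
    | succ k ih =>
      filter_upwards [hstep _ (by positivity) ih ε hε] with n hn
      rw [pow_succ]; linarith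
  rw [Metric.tendsto_nhds]
  intro ε hε
  have hpow : Tendsto (fun k : ℕ => D₀ * (1 / 2 : ℝ) ^ k) atTop (𝓝 0) := by
    simpa using (tendsto_pow_atTop_nhds_zero_of_lt_one (r := (1 / 2 : ℝ)) (by norm_num)
      (by norm_num)).const_mul D₀
  obtain ⟨k, hk⟩ := (hpow.eventually (gt_mem_nhds (by positivity : 0 < ε / 4))).exists
  filter_upwards [key (ε / 4) (by positivity) k] with n hn
  rw [Real.dist_eq, sub_zero, abs_of_nonneg (hd n)]
  linarith

/-- If `f = a + b / g - c / (g h)` with `a → A`, `b → B`, `c → C`, then `f` is eventually closer to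
the fixed point `μ` of `x ↦ A + B / x - C / x ^ 2` than `g` and `h` are, up to an arbitrarily small
error, provided that `g`, `h` and `μ` stay in the region `[M, ∞)` where this map contracts. -/
theorem contraction_step {f g h a b c : ℕ → ℝ} {A B C M μ : ℝ} (hM : 1 ≤ M) (hμ : M ≤ μ)
    (hB : 0 ≤ B) (hC : 0 ≤ C) (hfix : μ = A + B / μ - C / μ ^ 2)
    (hq : B / M ^ 2 + 2 * C / M ^ 3 ≤ 1 / 2)
    (ha : Tendsto a atTop (𝓝 A)) (hb : Tendsto b atTop (𝓝 B)) (hc : Tendsto c atTop (𝓝 C))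
    (hg : ∀ᶠ n in atTop, M ≤ g n) (hh : ∀ᶠ n in atTop, M ≤ h n)
    (hf : ∀ᶠ n in atTop, f n = a n + b n / g n - c n / (g n * h n))
    {D : ℝ} (hD : 0 ≤ D) (hgD : ∀ᶠ n in atTop, |g n - μ| ≤ D) (hhD : ∀ᶠ n in atTop, |h n - μ| ≤ D)
    {ε : ℝ} (hε : 0 < ε) : ∀ᶠ n in atTop, |f n - μ| ≤ D / 2 + ε := by
  have hε3 : 0 < ε / 3 := by positivity
  have ea := (Metric.tendsto_nhds.1 ha) _ hε3
  have eb := (Metric.tendsto_nhds.1 hb) _ hε3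
  have ec := (Metric.tendsto_nhds.1 hc) _ hε3
  filter_upwards [ea, eb, ec, hg, hh, hf, hgD, hhD] with n ea eb ec hg hh hf hgD hhD
  rw [Real.dist_eq] at ea eb ec
  have hM0 : 0 < M := by linarith
  have hg0 : 0 < g n := by linarith
  have hh0 : 0 < h n := by linarith
  have hμ0 : 0 < μ := by linarith
  have t1 : |(b n - B) / g n| ≤ ε / 3 := by
    rw [abs_div, abs_of_pos hg0, div_le_iff₀ hg0]
    nlinarith [abs_nonneg (b n - B)]
  have t2 : |(c n - C) / (g n * h n)| ≤ ε / 3 := by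
    have : 1 ≤ g n * h n := by nlinarith
    rw [abs_div, abs_of_pos (mul_pos hg0 hh0), div_le_iff₀ (mul_pos hg0 hh0)]
    nlinarith [abs_nonneg (c n - C)]
  have t3 : |1 / g n - 1 / μ| ≤ D / M ^ 2 := by
    have e : 1 / g n - 1 / μ = -(g n - μ) / (g n * μ) := by field_simp; ring
    rw [e, abs_div, abs_neg, abs_of_pos (mul_pos hg0 hμ0)]
    have : M ^ 2 ≤ g n * μ := by nlinarith
    gcongr
  have t4 : |1 / h n - 1 / μ| ≤ D / M ^ 2 := by
    have e : 1 / h n - 1 / μ = -(h n - μ) / (h n * μ) := by field_simp; ring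
    rw [e, abs_div, abs_neg, abs_of_pos (mul_pos hh0 hμ0)]
    have : M ^ 2 ≤ h n * μ := by nlinarith
    gcongr
  have t5 : |1 / (g n * h n) - 1 / μ ^ 2| ≤ 2 * D / M ^ 3 := by
    have e : 1 / (g n * h n) - 1 / μ ^ 2 =
        (1 / g n - 1 / μ) * (1 / h n) + (1 / h n - 1 / μ) * (1 / μ) := by field_simp; ring
    have b1 : |1 / h n| ≤ 1 / M := by rw [abs_of_pos (by positivity)]; gcongr
    have b2 : |1 / μ| ≤ 1 / M := by rw [abs_of_pos (by positivity)]; gcongr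
    rw [e]
    calc _ ≤ |1 / g n - 1 / μ| * |1 / h n| + |1 / h n - 1 / μ| * |1 / μ| := by
          rw [← abs_mul, ← abs_mul]; exact abs_add_le _ _
      _ ≤ D / M ^ 2 * (1 / M) + D / M ^ 2 * (1 / M) := by gcongr
      _ = 2 * D / M ^ 3 := by field_simp; ring
  have e : f n - μ = (a n - A) + (b n - B) / g n + B * (1 / g n - 1 / μ)
      - (c n - C) / (g n * h n) - C * (1 / (g n * h n) - 1 / μ ^ 2) := by
    rw [hf]; nth_rewrite 1 [hfix]; ring
  have t6 : |B * (1 / g n - 1 / μ)| ≤ B * (D / M ^ 2) := by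
    rw [abs_mul, abs_of_nonneg hB]; gcongr
  have t7 : |C * (1 / (g n * h n) - 1 / μ ^ 2)| ≤ C * (2 * D / M ^ 3) := by
    rw [abs_mul, abs_of_nonneg hC]; gcongr
  have t8 : B * (D / M ^ 2) + C * (2 * D / M ^ 3) ≤ D / 2 := by
    calc _ = D * (B / M ^ 2 + 2 * C / M ^ 3) := by ring
      _ ≤ D * (1 / 2) := by gcongr
      _ = _ := by ring
  rw [e, abs_le]
  rw [abs_le] at t1 t2 t6 t7
  have ea' := abs_lt.1 ea
  constructor <;> linarith [t1.1, t1.2, t2.1, t2.2, t6.1, t6.2, t7.1, t7.2, ea'.1, ea'.2]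

/-! ### Ratios, logarithmic limits and the characteristic roots -/

theorem eventually_shift {p : ℕ → Prop} (k : ℕ) :
    (∀ᶠ n in atTop, p (n + k)) ↔ ∀ᶠ n in atTop, p n := by
  rw [← eventually_map (m := fun n => n + k), map_add_atTop_eq_nat]

/-- The ratios of an increasing solution converge to the largest characteristic root. -/
theorem ShiftedRecursion.tendsto_ratio {x : ℕ → ℝ} (h : ShiftedRecursion x) (h0 : 0 ≤ x 0)
    (h1 : x 0 ≤ x 1) (h2 : x 1 ≤ x 2) (hp : 0 < x 1) {μ : ℝ} (hμ : 100 ≤ μ)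
    (hroot : μ ^ 3 - 188 * μ ^ 2 - 2368 * μ + 4 = 0) :
    Tendsto (fun n => x (n + 1) / x n) atTop (𝓝 μ) := by
  have hpos := h.pos h0 h1 h2 hp
  have ha : Tendsto (fun m : ℕ => recC2 m / recC3 m) atTop (𝓝 188) := by
    convert tendsto_div_of_tendsto_div_pow 9 (by norm_num) tendsto_recC2 tendsto_recC3 using 2
    norm_num
  have hb : Tendsto (fun m : ℕ => recC1 m / recC3 m) atTop (𝓝 2368) := by
    convert tendsto_div_of_tendsto_div_pow 9 (by norm_num) tendsto_recC1 tendsto_recC3 using 2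
    norm_num
  have hc : Tendsto (fun m : ℕ => recC0 m / recC3 m) atTop (𝓝 4) := by
    convert tendsto_div_of_tendsto_div_pow 9 (by norm_num) tendsto_recC0 tendsto_recC3 using 2
    norm_num
  set y : ℕ → ℝ := fun n => x (n + 1) / x n with hy
  have hf : ∀ᶠ n : ℕ in atTop, y (n + 2) =
      recC2 n / recC3 n + recC1 n / recC3 n / y (n + 1)
        - recC0 n / recC3 n / (y (n + 1) * y n) := by
    filter_upwards [eventually_ge_atTop 1] with n hn
    have p0 := hpos n hn
    have p1 := hpos (n + 1) (by omega)
    have p2 := hpos (n + 2) (by omega)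
    have hr := h n
    have p3 := recC3_pos n
    simp only [hy]
    rw [show n + 2 + 1 = n + 3 by omega, show n + 1 + 1 = n + 2 by omega]
    have e : x (n + 3) = (recC2 n * x (n + 2) + recC1 n * x (n + 1) - recC0 n * x n) / recC3 n := by
      rw [← hr]; field_simp
    rw [e]
    field_simp
  -- Since `x_m ≤ x_{m+1}` and `γ ≤ β`, the last two terms of the recursion add up to a nonnegative
  -- number, and the ratios are bounded below by `α → 188`.
  have hyge : ∀ᶠ n : ℕ in atTop, recC2 n / recC3 n ≤ y (n + 2) := by
    filter_upwards [eventually_ge_atTop 1] with n hn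
    have p2 := hpos (n + 2) (by omega)
    have hr := h n
    have hm := h.nonneg_and_le_succ h0 h1 h2 n
    have b1 := mul_le_mul_of_nonneg_left hm.2 (recC0_pos n).le
    have b2 := mul_le_mul_of_nonneg_right (recC0_le_recC1 n) (hm.1.trans hm.2)
    simp only [hy]
    rw [show n + 2 + 1 = n + 3 by omega, div_le_div_iff₀ (recC3_pos n) p2]
    linarith
  have hM : ∀ᶠ n : ℕ in atTop, 100 ≤ y n := by
    rw [← eventually_shift 2]
    filter_upwards [hyge, ha.eventually (lt_mem_nhds (by norm_num : (100 : ℝ) < 188))] with n h h'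
    linarith
  have hM1 : ∀ᶠ n : ℕ in atTop, 100 ≤ y (n + 1) := (eventually_shift 1).2 hM
  have hμ0 : μ ≠ 0 := by linarith
  have hbound : ∀ᶠ n : ℕ in atTop, |y n - μ| ≤ 300 + μ := by
    rw [← eventually_shift 2]
    filter_upwards [hf, hM, hM1, ha.eventually (gt_mem_nhds (by norm_num : (188 : ℝ) < 200)),
      hb.eventually (gt_mem_nhds (by norm_num : (2368 : ℝ) < 5000)),
      (eventually_shift 2).2 hM] with n hf hM hM1 ha hb hM2
    have c1 : recC1 n / recC3 n / y (n + 1) ≤ 5000 / 100 := by gcongr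
    have c2 : 0 ≤ recC0 n / recC3 n / (y (n + 1) * y n) := by
      have := recC0_pos n
      have := recC3_pos n
      positivity
    rw [abs_le]
    constructor <;> linarith
  have hd : Tendsto (fun n => |y n - μ|) atTop (𝓝 0) := by
    refine tendsto_zero_of_eventual_halving (fun n => abs_nonneg _) (by linarith) hbound ?_
    intro D hD hev ε hε
    rw [← eventually_shift 2]
    exact contraction_step (M := 100) (A := 188) (B := 2368) (C := 4) (by norm_num) hμ
      (by norm_num) (by norm_num) (by field_simp; linarith) (by norm_num) ha hb hc hM1 hM hf hD
      ((eventually_shift 1).2 hev) hev hε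
  rw [tendsto_iff_norm_sub_tendsto_zero]
  exact hd

/-- The reciprocal ratios of a rapidly decreasing positive solution converge. The fixed point
equation says that `1 / μ` is a characteristic root. -/
theorem ShiftedRecursion.tendsto_backward_ratio {x : ℕ → ℝ} (h : ShiftedRecursion x)
    (hpos : ∀ n, 0 < x n) (hdec : ∀ n, x (n + 1) ≤ x n / 40) {μ : ℝ} (hμ : 40 ≤ μ)
    (hroot : μ = 592 + 47 / μ - (1 / 4) / μ ^ 2) :
    Tendsto (fun n => x n / x (n + 1)) atTop (𝓝 μ) := by
  have ha : Tendsto (fun m : ℕ => recC1 m / recC0 m) atTop (𝓝 592) := by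
    convert tendsto_div_of_tendsto_div_pow 9 (by norm_num) tendsto_recC1 tendsto_recC0 using 2
    norm_num
  have hb : Tendsto (fun m : ℕ => recC2 m / recC0 m) atTop (𝓝 47) := by
    convert tendsto_div_of_tendsto_div_pow 9 (by norm_num) tendsto_recC2 tendsto_recC0 using 2
    norm_num
  have hc : Tendsto (fun m : ℕ => recC3 m / recC0 m) atTop (𝓝 (1 / 4)) := by
    convert tendsto_div_of_tendsto_div_pow 9 (by norm_num) tendsto_recC3 tendsto_recC0 using 2
    norm_num
  set y : ℕ → ℝ := fun n => x n / x (n + 1) with hy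
  have hf : ∀ n : ℕ, y n = recC1 n / recC0 n + recC2 n / recC0 n / y (n + 1)
      - recC3 n / recC0 n / (y (n + 1) * y (n + 2)) := by
    intro n
    have p1 := hpos (n + 1)
    have p2 := hpos (n + 2)
    have p3 := hpos (n + 3)
    have hr := h n
    have q0 := recC0_pos n
    simp only [hy]
    rw [show n + 2 + 1 = n + 3 by omega, show n + 1 + 1 = n + 2 by omega]
    have e : x n = (recC2 n * x (n + 2) + recC1 n * x (n + 1) - recC3 n * x (n + 3)) / recC0 n := by
      rw [hr]; field_simp; ring
    rw [e]
    field_simp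
    ring
  have hM : ∀ n, 40 ≤ y n := by
    intro n
    simp only [hy]
    rw [le_div_iff₀ (hpos _)]
    linarith [hdec n]
  have hbound : ∀ᶠ n : ℕ in atTop, |y n - μ| ≤ 1000 + μ := by
    filter_upwards [ha.eventually (gt_mem_nhds (by norm_num : (592 : ℝ) < 600)),
      hb.eventually (gt_mem_nhds (by norm_num : (47 : ℝ) < 400))] with n ha hb
    have c1 : recC2 n / recC0 n / y (n + 1) ≤ 400 / 40 := by
      have := hM (n + 1)
      gcongr
    have c2 : 0 ≤ recC3 n / recC0 n / (y (n + 1) * y (n + 2)) := by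
      have := recC0_pos n
      have := recC3_pos n
      have := hM (n + 1)
      have := hM (n + 2)
      positivity
    have := hf n
    have := hM n
    rw [abs_le]
    constructor <;> linarith
  have hd : Tendsto (fun n => |y n - μ|) atTop (𝓝 0) := by
    refine tendsto_zero_of_eventual_halving (fun n => abs_nonneg _) (by linarith) hbound ?_
    intro D hD hev ε hε
    exact contraction_step (M := 40) (A := 592) (B := 47) (C := 1 / 4) (by norm_num) hμ
      (by norm_num) (by norm_num) hroot (by norm_num) ha hb hc
      (Eventually.of_forall fun n => hM (n + 1)) (Eventually.of_forall fun n => hM (n + 2))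
      (Eventually.of_forall hf) hD
      ((eventually_shift 1).2 hev) ((eventually_shift 2).2 hev) hε
  rw [tendsto_iff_norm_sub_tendsto_zero]
  exact hd

theorem tendsto_log_abs_div_of_ratio {x : ℕ → ℝ} {l : ℝ} (hl : 0 < l)
    (hpos : ∀ n, 1 ≤ n → 0 < x n) (h : Tendsto (fun n => x (n + 1) / x n) atTop (𝓝 l)) :
    Tendsto (fun n : ℕ => Real.log |x n| / (n : ℝ)) atTop (𝓝 (Real.log l)) := by
  -- The value `Real.log |x 0|` may be junk (`x 0 = 0` is possible); it is divided by `n`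
  -- in the end.
  have h1 : Tendsto (fun n => Real.log |x (n + 1)| - Real.log |x n|) atTop (𝓝 (Real.log l)) := by
    refine ((Real.continuousAt_log hl.ne').tendsto.comp h).congr' ?_
    filter_upwards [eventually_ge_atTop 1] with n hn
    have p0 := hpos n hn
    have p1 := hpos (n + 1) (by omega)
    rw [Function.comp_apply, Real.log_div p1.ne' p0.ne', abs_of_pos p0, abs_of_pos p1]
  have h2 := h1.cesaro
  simp only [Finset.sum_range_sub (fun n => Real.log |x n|)] at h2
  have h3 : Tendsto (fun n : ℕ => (n : ℝ)⁻¹ * Real.log |x 0|) atTop (𝓝 0) := by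
    simpa using (tendsto_inv_atTop_nhds_zero_nat (𝕜 := ℝ)).mul_const (Real.log |x 0|)
  have h4 := h2.add h3
  rw [add_zero] at h4
  refine h4.congr fun n => ?_
  rw [div_eq_inv_mul]; ring

/-- The outer two roots come from sign changes on `(0, 1 / 40)` and `(199, 200)`. The middle one is
determined by the sum of the roots and lies near `-12`. -/
theorem exists_recCharPoly_roots : ∃ l₁ l₂ l₃ : ℝ,
    recCharPoly = (Polynomial.X - Polynomial.C l₁) * (Polynomial.X - Polynomial.C l₂) *
      (Polynomial.X - Polynomial.C l₃) ∧
    |l₁| < |l₂| ∧ |l₂| < |l₃| ∧ 0 < l₁ ∧ l₁ ≤ 1 / 40 ∧ 100 ≤ l₃ ∧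
    l₁ ^ 3 - 188 * l₁ ^ 2 - 2368 * l₁ + 4 = 0 ∧ l₃ ^ 3 - 188 * l₃ ^ 2 - 2368 * l₃ + 4 = 0 := by
  have hcont : Continuous fun t : ℝ => t ^ 3 - 188 * t ^ 2 - 2368 * t + 4 := by fun_prop
  obtain ⟨a, ha, hap⟩ : ∃ a ∈ Set.Ioo (0 : ℝ) (1 / 40), a ^ 3 - 188 * a ^ 2 - 2368 * a + 4 = 0 :=
    intermediate_value_Ioo' (by norm_num) hcont.continuousOn ⟨by norm_num, by norm_num⟩
  obtain ⟨b, hb, hbp⟩ : ∃ b ∈ Set.Ioo (199 : ℝ) 200, b ^ 3 - 188 * b ^ 2 - 2368 * b + 4 = 0 :=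
    intermediate_value_Ioo (by norm_num) hcont.continuousOn ⟨by norm_num, by norm_num⟩
  have e2 : a ^ 2 + a * b + b ^ 2 - 188 * (a + b) - 2368 = 0 := by
    have : (b - a) * (a ^ 2 + a * b + b ^ 2 - 188 * (a + b) - 2368) = 0 := by
      linear_combination hbp - hap
    rcases mul_eq_zero.1 this with h | h
    · linarith [ha.2, hb.1]
    · exact h
  refine ⟨a, 188 - a - b, b, ?_, ?_, ?_, ha.1, ha.2.le, by linarith [hb.1], hap, hbp⟩
  · have c2 : a * (188 - a - b) + a * b + (188 - a - b) * b = -2368 := by linear_combination -e2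
    have c3 : a * (188 - a - b) * b = -4 := by linear_combination -a * e2 + hap
    have p2 := congrArg (Polynomial.C : ℝ → ℝ[X]) c2
    have p3 := congrArg (Polynomial.C : ℝ → ℝ[X]) c3
    have p1 : Polynomial.C (188 - a - b) =
        Polynomial.C (188 : ℝ) - Polynomial.C a - Polynomial.C b := by simp only [map_sub]
    simp only [map_add, map_mul, map_neg, p1] at p2 p3
    rw [recCharPoly, p1]
    linear_combination -Polynomial.X * p2 + p3
  · rw [abs_of_pos ha.1, abs_of_neg (by linarith [ha.1, hb.1])]
    linarith [ha.1, ha.2, hb.1]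
  · rw [abs_of_neg (by linarith [ha.1, hb.1]), abs_of_pos (by linarith [hb.1])]
    linarith [ha.1, ha.2, hb.1]

theorem realZeta_pos (s : ℕ) (hs : 1 < s) : 0 < realZeta s :=
  (summable_one_div_succ_pow s hs).tsum_pos (fun k => by positivity) 0 (by positivity)

theorem shiftedRecursion_wpSum (s : ℕ) (hs : s ≤ 6) (hs0 : 0 < s) :
    ShiftedRecursion fun n => (wpSum s n : ℝ) := by
  intro m
  have h := congrArg (Rat.castHom ℝ) (wpSum_recursion s m hs hs0)
  simp only [map_add, map_sub, map_mul, map_pow, map_ofNat, map_natCast, map_one, map_zero,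
    map_recB0, map_recB1, map_recB2] at h
  simp only [Rat.coe_castHom] at h
  simp only [recC3, recC2, recC1, recC0]
  linear_combination h

theorem shiftedRecursion_wpR : ShiftedRecursion wpR := by
  intro m
  simp only [recC3, recC2, recC1, recC0]
  linear_combination wpR_recursion m

theorem wpV_eq (n : ℕ) :
    (wpV n : ℝ) = (wpU n : ℝ) * realZeta 5 + (wpW n : ℝ) * realZeta 3 - wpR n := by
  rw [wpR_eq]; ring

theorem shiftedRecursion_wpU : ShiftedRecursion fun n => (wpU n : ℝ) :=
  shiftedRecursion_wpSum 5 (by norm_num) (by norm_num)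

theorem shiftedRecursion_wpW : ShiftedRecursion fun n => (wpW n : ℝ) :=
  shiftedRecursion_wpSum 3 (by norm_num) (by norm_num)

theorem shiftedRecursion_wpV : ShiftedRecursion fun n => (wpV n : ℝ) := by
  intro m
  have hu := shiftedRecursion_wpU m
  have hw := shiftedRecursion_wpW m
  have hr := shiftedRecursion_wpR m
  simp only [wpV_eq] at *
  linear_combination realZeta 5 * hu + realZeta 3 * hw - hr

/-- The first values of `v_n` are compared through the linear form, since `r_n` is small against
`u_n ζ(5) + w_n ζ(3)`. -/
theorem wpV_initial : (wpV 0 : ℝ) = 0 ∧ 0 < (wpV 1 : ℝ) ∧ (wpV 1 : ℝ) ≤ wpV 2 := by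
  have z5 := realZeta_pos 5 (by norm_num)
  have z3 := realZeta_pos 3 (by norm_num)
  have r0 := wpR_zero
  have r1 := wpR_succ_le 0
  have r2 := wpR_succ_le 1
  have p1 := wpR_pos 1
  rw [zero_add, r0] at r1
  simp only [wpV_eq, wpU_zero, wpW_zero, wpU_one, wpW_one, wpU_two, wpW_two, r0]
  norm_num at r2 ⊢
  constructor <;> linarith

/-! ### Conclusion -/

theorem theorem2 :
    (∀ n : ℕ, Summable (fun k : ℕ => wpTerm n ((k : ℝ) + 1)) ∧
      ((wpR n : ℝ) : ℂ) =
        (wpU n : ℂ) * riemannZeta 5 + (wpW n : ℂ) * riemannZeta 3 - (wpV n : ℂ)) ∧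
    (SatisfiesRecursion wpR ∧
      SatisfiesRecursion (fun n => (wpU n : ℝ)) ∧
      SatisfiesRecursion (fun n => (wpW n : ℝ)) ∧
      SatisfiesRecursion (fun n => (wpV n : ℝ))) ∧
    (∀ n : ℕ, 1 ≤ n → 0 < wpR n ∧ 0 < wpU n ∧ 0 < wpW n ∧ 0 < wpV n) ∧
    ∃ l₁ l₂ l₃ : ℝ,
      recCharPoly =
        (Polynomial.X - Polynomial.C l₁) * (Polynomial.X - Polynomial.C l₂) *
          (Polynomial.X - Polynomial.C l₃) ∧
      |l₁| < |l₂| ∧ |l₂| < |l₃| ∧ 0 < l₁ ∧ 0 < l₃ ∧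
      Tendsto (fun n : ℕ => Real.log |wpR n| / (n : ℝ)) atTop (𝓝 (Real.log l₁)) ∧
      Tendsto (fun n : ℕ => Real.log |(wpU n : ℝ)| / (n : ℝ)) atTop (𝓝 (Real.log l₃)) ∧
      Tendsto (fun n : ℕ => Real.log |(wpW n : ℝ)| / (n : ℝ)) atTop (𝓝 (Real.log l₃)) ∧
      Tendsto (fun n : ℕ => Real.log |(wpV n : ℝ)| / (n : ℝ)) atTop (𝓝 (Real.log l₃)) := by
  have hu := shiftedRecursion_wpU
  have hw := shiftedRecursion_wpW
  have hv := shiftedRecursion_wpV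
  obtain ⟨v0, v1, v2⟩ := wpV_initial
  have u0 : 0 ≤ (wpU 0 : ℝ) := by rw [wpU_zero]; norm_num
  have u1 : (wpU 0 : ℝ) ≤ wpU 1 := by rw [wpU_zero, wpU_one]; norm_num
  have u2 : (wpU 1 : ℝ) ≤ wpU 2 := by rw [wpU_one, wpU_two]; norm_num
  have up : 0 < (wpU 1 : ℝ) := by rw [wpU_one]; norm_num
  have w0 : 0 ≤ (wpW 0 : ℝ) := by rw [wpW_zero]; norm_num
  have w1 : (wpW 0 : ℝ) ≤ wpW 1 := by rw [wpW_zero, wpW_one]; norm_num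
  have w2 : (wpW 1 : ℝ) ≤ wpW 2 := by rw [wpW_one, wpW_two]; norm_num
  have wp : 0 < (wpW 1 : ℝ) := by rw [wpW_one]; norm_num
  have hup := hu.pos u0 u1 u2 up
  have hwp := hw.pos w0 w1 w2 wp
  have hvp := hv.pos v0.ge (v0.trans_le v1.le) v2 v1
  obtain ⟨l₁, l₂, l₃, hpoly, h12, h23, hl₁, hl₁', hl₃, hr₁, hr₃⟩ := exists_recCharPoly_roots
  have hl₃' : 0 < l₃ := by linarith
  refine ⟨fun n => ⟨summable_wpTerm n, ?_⟩,
    ⟨shiftedRecursion_wpR.satisfiesRecursion, hu.satisfiesRecursion, hw.satisfiesRecursion,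
      hv.satisfiesRecursion⟩,
    fun n hn => ⟨wpR_pos n, by exact_mod_cast hup n hn, by exact_mod_cast hwp n hn,
      by exact_mod_cast hvp n hn⟩,
    l₁, l₂, l₃, hpoly, h12, h23, hl₁, hl₃', ?_,
    tendsto_log_abs_div_of_ratio hl₃' hup (hu.tendsto_ratio u0 u1 u2 up hl₃ hr₃),
    tendsto_log_abs_div_of_ratio hl₃' hwp (hw.tendsto_ratio w0 w1 w2 wp hl₃ hr₃),
    tendsto_log_abs_div_of_ratio hl₃' hvp
      (hv.tendsto_ratio v0.ge (v0.trans_le v1.le) v2 v1 hl₃ hr₃)⟩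
  · have h5 := riemannZeta_eq_realZeta 5 (by norm_num)
    have h3 := riemannZeta_eq_realZeta 3 (by norm_num)
    norm_num at h5 h3
    rw [h5, h3, wpR_eq]
    push_cast
    rfl
  · have hμ : 40 ≤ 1 / l₁ := by rw [le_div_iff₀ hl₁]; linarith
    have h := shiftedRecursion_wpR.tendsto_backward_ratio wpR_pos wpR_succ_le hμ
      (by field_simp; linarith)
    have h' := h.inv₀ (by positivity)
    simp only [inv_div, one_div, inv_inv] at h'
    exact tendsto_log_abs_div_of_ratio hl₁ (fun n _ => wpR_pos n) h'
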